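/- Let $\mathbb K$ be a field of characteristic $0$ and let $A=\bigoplus_{i\in\mathbb Z}A_i$ be a graded vector space over $\mathbb K$. Let $V=sA$ be its suspension, $V_i=A_{i-1}$, with $s:A\to V$ of degree $1$. **$\mathrm{Dend}_\infty$-structures.** Let $C_k=\{[1],\dots,[k]\}$. For $m,n\ge 1$ and $1\le i\le m$ let $R_0^{m,n,i}:C_{m+n-1}\to C_m$ send $[r]$ to $[r]$ if $r\le i-1$, to $[i]$ if $i\le r\le i+n-1$, and to $[r-n+1]$ if $r\ge i+n$. Let $R_i^{m,n,i}:C_{m+n-1}\to\mathbb K[C_n]$ send $[r]$ to $[r-i+1]$ if $i\le r\le i+n-1$, and to $[1]+\cdots+[n]$ otherwise. A $\mathrm{Dend}_\infty$-algebra structure on $A$ is a family of multilinear maps $\mu_{k,[r]}:A^{\otimes k}\to A$ ($k\ge 1$, $[r]\in C_k$) of degree $k-2$, with $\mu_{k,x}$ extended linearly to $x\in\mathbb K[C_k]$, such that for all $n\ge1$, $[r]\in C_n$ and homogeneous $a_1,\dots,a_n\in A$ $$\sum_{i+j=n+1}\ \sum_{\lambda=1}^{j}(-1)^{\lambda(i+1)+i(|a_1|+\cdots+|a_{\lambda-1}|)}\,\mu_{j,R_0^{j,i,\lambda}[r]}\big(a_1,\dots,a_{\lambda-1},\mu_{i,R_\lambda^{j,i,\lambda}[r]}(a_\lambda,\dots,a_{\lambda+i-1}),a_{\lambda+i},\dots,a_n\big)=0,$$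 where $i,j\ge 1$. **Coderivations.** Let $\mathrm{Diass}^c(V)=TV\otimes V\otimes TV$, with $TV$ the tensor algebra, graded by the total degree of the letters, with the coproducts $$\triangle_1(v_1\cdots v_n\otimes v\otimes w_1\cdots w_m)=\sum_{i,j\ge0,\ i+j+1\le m}(v_1\cdots v_n\otimes v\otimes w_1\cdots w_i)\otimes(w_{i+1}\cdots w_{i+j}\otimes w_{i+j+1}\otimes w_{i+j+2}\cdots w_m),$$ $$\triangle_2(v_1\cdots v_n\otimes v\otimes w_1\cdots w_m)=\sum_{i,j\ge0,\ i+j+1\le n}(v_1\cdots v_i\otimes v_{i+1}\otimes v_{i+2}\cdots v_{i+j+1})\otimes(v_{i+j+2}\cdots v_n\otimes v\otimes w_1\cdots w_m).$$ A coderivation of degree $-1$ is a linear map $D$ of degree $-1$ on $\mathrm{Diass}^c(V)$ with $\triangle_q\circ D=(\mathrm{id}\otimes D+D\otimes\mathrm{id})\circ\triangle_q$ for $q=1,2$, where $(\mathrm{id}\otimes D)(x\otimes y)=(-1)^{|x|}x\otimes D(y)$ for homogeneous $x$. **Theorem.** There is a bijection $\mu\mapsto D_\mu$ from the set of $\mathrm{Dend}_\infty$-algebra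 structures on $A$ onto the set of coderivations $D$ of degree $-1$ of $\mathrm{Diass}^c(V)$ with $D\circ D=0$, such that for all $k\ge1$, $1\le r\le k$ and homogeneous $v_1,\dots,v_k\in V$ $$\pi\big(D_\mu(v_1\cdots v_{r-1}\otimes v_r\otimes v_{r+1}\cdots v_k)\big)=\big(s\circ\mu_{k,[r]}\circ(s^{-1})^{\otimes k}\big)(v_1,\dots,v_k)=(-1)^{\sum_{t=1}^k(k-t)|v_t|}\,s\,\mu_{k,[r]}(s^{-1}v_1,\dots,s^{-1}v_k),$$ where $\pi:TV\otimes V\otimes TV\to V$ is the projection that maps $1\otimes v\otimes 1$ to $v$ and every word with more than one letter to $0$. -/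

import Mathlib

open scoped TensorProduct

noncomputable section

namespace DendInfty

section Operations

variable {K A : Type*} [Field K] [AddCommGroup A] [Module K A]

/-- A family of multilinear operations `μ_{k,[r]} : A^{⊗ k} → A`, one for each `k ≥ 1` and each
symbol `[r] ∈ C_k = {[1], …, [k]}`. The symbol `[r]` is the element `r - 1` of `Fin k`; as `Fin 0`
is empty, there is no operation with `k = 0`. -/
abbrev Ops (K A : Type*) [Field K] [AddCommGroup A] [Module K A] :=
  (k : ℕ) → Fin k → MultilinearMap K (fun _ : Fin k => A) A

/-- The linear extension `μ_{k,x}` of `[r] ↦ μ_{k,[r]}` to formal sums `x ∈ K[C_k]`. -/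
def opLin (μ : Ops K A) (k : ℕ) (x : Fin k →₀ K) : MultilinearMap K (fun _ : Fin k => A) A :=
  Finsupp.linearCombination K (μ k) x

/-- The map `R_0(m; 1, …, n, …, 1) : C_{m+n-1} → C_m` with `n` in the place `i` (counted from `0`,
like the symbols). -/
def outerSymbol {N m n : ℕ} (h : N + 1 = m + n) (i : Fin m) (r : Fin N) : Fin m :=
  ⟨if (r : ℕ) < i then r else if (r : ℕ) < i + n then i else r + 1 - n, by
    have := r.2; have := i.2; split_ifs <;> omega⟩

/-- The map `R_i(m; 1, …, n, …, 1) : C_{m+n-1} → K[C_n]` with `n` in the place `i` (counted from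
`0`): it sends the symbols of the block `i, …, i + n - 1` to those of `C_n`, in order, and every
other symbol to the sum of all the elements of `C_n`. -/
def innerSymbol (K : Type*) [Field K] {N m : ℕ} (n : ℕ) (i : Fin m) (r : Fin N) : Fin n →₀ K :=
  if h : (i : ℕ) ≤ r ∧ (r : ℕ) < i + n then Finsupp.single ⟨r - i, by omega⟩ 1
  else ∑ t : Fin n, Finsupp.single t 1

/-- `μ_{m, R_0[r]}(a_1, …, a_{i-1}, μ_{n, R_i[r]}(a_i, …, a_{i+n-1}), a_{i+n}, …, a_N)`
with `N = m + n - 1` (here `i`, `r` and the indices of the arguments are counted from `0`). -/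
def partialComp (μ : Ops K A) {N m n : ℕ} (h : N + 1 = m + n) (i : Fin m) (r : Fin N)
    (a : Fin N → A) : A :=
  μ m (outerSymbol h i r) fun t : Fin m =>
    if h₁ : t < i then a ⟨t, by have := t.2; have := i.2; omega⟩
    else if h₂ : t = i then
      opLin μ n (innerSymbol K n i r) fun u : Fin n =>
        a ⟨i + u, by have := u.2; have := i.2; omega⟩
    else a ⟨t + n - 1, by have := t.2; have := i.2; omega⟩

/-- A `Dend_∞`-algebra structure on the graded vector space `A = ⨁ 𝒜 i`: operations `μ_{k,[r]}` of
degree `k - 2` such that for all `N ≥ 1`, `[r] ∈ C_N` and homogeneous `a_1, …, a_N`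
`∑_{i+j=N+1} ∑_{λ=1}^{j} (-1)^{λ(i+1) + i(|a_1|+⋯+|a_{λ-1}|)}
  μ_{j,R_0[r]}(a_1, …, a_{λ-1}, μ_{i,R_λ[r]}(a_λ, …), …, a_N) = 0`.
Below `i = p + 1`, `j = N - p` and `λ = l + 1`. -/
structure IsDendInfty (𝒜 : ℤ → Submodule K A) (μ : Ops K A) : Prop where
  degree : ∀ (k : ℕ) (r : Fin k) (a : Fin k → A) (d : Fin k → ℤ), (∀ t, a t ∈ 𝒜 (d t)) →
    μ k r a ∈ 𝒜 ((∑ t, d t) + ((k : ℤ) - 2))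
  identity : ∀ (N : ℕ) (r : Fin N) (a : Fin N → A) (d : Fin N → ℤ), (∀ t, a t ∈ 𝒜 (d t)) →
    ∑ p : Fin N, ∑ l : Fin (N - p),
      (-1 : K) ^ (((l : ℤ) + 1) * ((p : ℤ) + 2)
          + ((p : ℤ) + 1) * ∑ t ∈ Finset.univ.filter (fun t : Fin N => (t : ℕ) < l), d t) •
        partialComp μ (m := N - p) (n := p + 1) (by have := p.2; omega) l r a = 0

end Operations

section Graded

variable {K A : Type*} [Field K] [AddCommGroup A] [Module K A]

/-- The suspension `sA` of a graded vector space: `(sA)_i = A_{i-1}`. The underlying vector space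
is not changed, so the degree `1` map `s : A → sA` and its inverse are the identity on vectors. -/
def suspension (𝒜 : ℤ → Submodule K A) : ℤ → Submodule K A := fun i => 𝒜 (i - 1)

theorem suspension_isInternal (𝒜 : ℤ → Submodule K A) [DirectSum.Decomposition 𝒜] :
    DirectSum.IsInternal (suspension 𝒜) := by
  have h := DirectSum.Decomposition.isInternal 𝒜
  rw [DirectSum.isInternal_submodule_iff_iSupIndep_and_iSup_eq_top] at h ⊢
  refine ⟨h.1.comp (f := fun i : ℤ => i - 1) fun a b hab => by simpa using hab, ?_⟩
  rw [← h.2]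
  exact (Equiv.subRight (1 : ℤ)).iSup_comp (g := 𝒜)

instance (𝒜 : ℤ → Submodule K A) [DirectSum.Decomposition 𝒜] :
    DirectSum.Decomposition (suspension 𝒜) :=
  (suspension_isInternal 𝒜).chooseDecomposition

/-- The linear map `v ↦ (-1)^{e |v|} v` of a graded vector space. -/
def signMap (𝒱 : ℤ → Submodule K A) [DirectSum.Decomposition 𝒱] (e : ℤ) : A →ₗ[K] A :=
  DirectSum.toModule K ℤ A (fun i => (-1 : K) ^ (e * i) • (𝒱 i).subtype) ∘ₗ
    (DirectSum.decomposeLinearEquiv 𝒱).toLinearMap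

theorem signMap_apply (𝒱 : ℤ → Submodule K A) [DirectSum.Decomposition 𝒱] (e : ℤ) {i : ℤ}
    {v : A} (hv : v ∈ 𝒱 i) : signMap 𝒱 e v = (-1 : K) ^ (e * i) • v := by
  simp only [signMap, LinearMap.comp_apply, LinearEquiv.coe_coe,
    DirectSum.decomposeLinearEquiv_apply, DirectSum.decompose_of_mem 𝒱 hv]
  exact DirectSum.toModule_lof (R := K) (ι := ℤ) (M := fun i => 𝒱 i) i ⟨v, hv⟩

end Graded

section Diass

variable (K V : Type*) [Field K] [AddCommGroup V] [Module K V]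

/-- The underlying vector space `TV ⊗ V ⊗ TV` of the free diassociative coalgebra
`Diass^c(V)`. -/
abbrev Diass := TensorAlgebra K V ⊗[K] (V ⊗[K] TensorAlgebra K V)

variable {V}

/-- The element `l_1 ⋯ l_n` of `TV`. -/
def monomial (l : List V) : TensorAlgebra K V := (l.map (TensorAlgebra.ι K)).prod

/-- The element `l_1 ⋯ l_n ⊗ v ⊗ r_1 ⋯ r_m` of `TV ⊗ V ⊗ TV`. -/
def word (l : List V) (v : V) (r : List V) : Diass K V :=
  monomial K l ⊗ₜ (v ⊗ₜ monomial K r)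

/-- The element `a_1 ⋯ a_{r-1} ⊗ a_r ⊗ a_{r+1} ⋯ a_n` of `TV ⊗ V ⊗ TV`. -/
def pointedWord {n : ℕ} (a : Fin n → V) (r : Fin n) : Diass K V :=
  word K ((List.ofFn a).take r) (a r) ((List.ofFn a).drop (r + 1))

variable (V)

/-- One step of the recursion for `deconc`: a letter `v` acts by
`(x, w) ↦ ((v ⊗ 1) x + 1 ⊗ v w, v w)`. -/
def deconcStep : V →ₗ[K]
    Module.End K ((TensorAlgebra K V ⊗[K] TensorAlgebra K V) × TensorAlgebra K V) where
  toFun v :=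
    let L := LinearMap.mulLeft K (TensorAlgebra.ι K v)
    LinearMap.prod
      ((TensorProduct.map L LinearMap.id).coprod
        (TensorProduct.mk K (TensorAlgebra K V) (TensorAlgebra K V) 1 ∘ₗ L))
      (L ∘ₗ LinearMap.snd K _ _)
  map_add' u v := by
    ext x <;> simp [add_mul, TensorProduct.add_tmul, TensorProduct.tmul_add]
  map_smul' c v := by
    ext x <;> simp [TensorProduct.smul_tmul']

/-- Deconcatenation `TV → TV ⊗ TV`, `w_1 ⋯ w_m ↦ ∑_{i=0}^{m} w_1 ⋯ w_i ⊗ w_{i+1} ⋯ w_m`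
(see `deconc_monomial`). -/
def deconc : TensorAlgebra K V →ₗ[K] TensorAlgebra K V ⊗[K] TensorAlgebra K V :=
  LinearMap.fst K _ _ ∘ₗ LinearMap.applyₗ (1 ⊗ₜ 1, 1) ∘ₗ
    (TensorAlgebra.lift K (deconcStep K V)).toLinearMap

/-- One step of the recursion for `pointings`: a letter `v` acts by
`(x, w) ↦ (v x + 1 ⊗ v ⊗ w, v w)`. -/
def pointingsStep : V →ₗ[K] Module.End K (Diass K V × TensorAlgebra K V) where
  toFun v :=
    let L := LinearMap.mulLeft K (TensorAlgebra.ι K v)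
    LinearMap.prod
      ((TensorProduct.map L LinearMap.id).coprod
        (TensorProduct.mk K (TensorAlgebra K V) (V ⊗[K] TensorAlgebra K V) 1 ∘ₗ
          TensorProduct.mk K V (TensorAlgebra K V) v))
      (L ∘ₗ LinearMap.snd K _ _)
  map_add' u v := by
    ext x <;> simp [add_mul, TensorProduct.add_tmul, TensorProduct.tmul_add]
  map_smul' c v := by
    ext x <;> simp [TensorProduct.smul_tmul']
    exact (congrArg _ (TensorProduct.smul_tmul' c v x).symm).trans
      (TensorProduct.smul_tmul c _ _).symm

/-- The map `TV → TV ⊗ V ⊗ TV`,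
`w_1 ⋯ w_m ↦ ∑_{i=1}^{m} w_1 ⋯ w_{i-1} ⊗ w_i ⊗ w_{i+1} ⋯ w_m` (see `pointings_monomial`). -/
def pointings : TensorAlgebra K V →ₗ[K] Diass K V :=
  LinearMap.fst K _ _ ∘ₗ LinearMap.applyₗ (0, 1) ∘ₗ
    (TensorAlgebra.lift K (pointingsStep K V)).toLinearMap

variable {V}

theorem deconc_monomial (w : List V) :
    deconc K V (monomial K w) =
      ∑ i ∈ Finset.range (w.length + 1), monomial K (w.take i) ⊗ₜ monomial K (w.drop i) := by
  have key : ∀ w : List V, TensorAlgebra.lift K (deconcStep K V) (monomial K w) (1 ⊗ₜ 1, 1) =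
      (∑ i ∈ Finset.range (w.length + 1), monomial K (w.take i) ⊗ₜ monomial K (w.drop i),
        monomial K w) := by
    intro w
    induction w with
    | nil => simp [monomial]
    | cons v w ih =>
      have : monomial K (v :: w) = TensorAlgebra.ι K v * monomial K w := by simp [monomial]
      rw [this, map_mul, Module.End.mul_apply, ih, TensorAlgebra.lift_ι_apply, List.length_cons,
        Finset.sum_range_succ' _ (w.length + 1)]
      simp [deconcStep, monomial, map_sum]
  exact congrArg Prod.fst (key w)

theorem pointings_monomial (w : List V) :
    pointings K V (monomial K w) =
      ∑ i : Fin w.length, word K (w.take i) w[i] (w.drop (i + 1)) := by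
  have key : ∀ w : List V, TensorAlgebra.lift K (pointingsStep K V) (monomial K w) (0, 1) =
      (∑ i : Fin w.length, word K (w.take i) w[i] (w.drop (i + 1)), monomial K w) := by
    intro w
    induction w with
    | nil => simp [monomial]
    | cons v w ih =>
      have : monomial K (v :: w) = TensorAlgebra.ι K v * monomial K w := by simp [monomial]
      rw [this, map_mul, Module.End.mul_apply, ih, TensorAlgebra.lift_ι_apply]
      simp [pointingsStep, monomial, word, map_sum, Fin.sum_univ_succ, add_comm]
  exact congrArg Prod.fst (key w)

variable (V)

/-- The coproduct `△₁` of `Diass^c(V)`: it cuts the word to the right of the distinguished letter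
and sums over the choices of a distinguished letter in the right half (see `comul₁_word`). -/
def comul₁ : Diass K V →ₗ[K] Diass K V ⊗[K] Diass K V :=
  (TensorProduct.assoc K (TensorAlgebra K V) (V ⊗[K] TensorAlgebra K V)
      (Diass K V)).symm.toLinearMap ∘ₗ
    TensorProduct.map LinearMap.id
      ((TensorProduct.assoc K V (TensorAlgebra K V) (Diass K V)).symm.toLinearMap ∘ₗ
        TensorProduct.map LinearMap.id
          (TensorProduct.map LinearMap.id (pointings K V) ∘ₗ deconc K V))

/-- The coproduct `△₂` of `Diass^c(V)`: it cuts the word to the left of the distinguished letter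
and sums over the choices of a distinguished letter in the left half (see `comul₂_word`). -/
def comul₂ : Diass K V →ₗ[K] Diass K V ⊗[K] Diass K V :=
  (TensorProduct.assoc K (Diass K V) (TensorAlgebra K V)
      (V ⊗[K] TensorAlgebra K V)).toLinearMap ∘ₗ
    TensorProduct.map
      (TensorProduct.map (pointings K V) LinearMap.id ∘ₗ deconc K V) LinearMap.id

variable {V}

theorem comul₁_word (l : List V) (v : V) (r : List V) :
    comul₁ K V (word K l v r) =
      ∑ i ∈ Finset.range (r.length + 1), ∑ j : Fin (r.drop i).length,
        word K l v (r.take i) ⊗ₜ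
          word K ((r.drop i).take j) (r.drop i)[j] ((r.drop i).drop (j + 1)) := by
  simp only [comul₁, LinearMap.comp_apply, word, TensorProduct.map_tmul, LinearMap.id_apply,
    deconc_monomial, map_sum, pointings_monomial, TensorProduct.tmul_sum, LinearEquiv.coe_coe,
    TensorProduct.assoc_symm_tmul]

theorem comul₂_word (l : List V) (v : V) (r : List V) :
    comul₂ K V (word K l v r) =
      ∑ i ∈ Finset.range (l.length + 1), ∑ j : Fin (l.take i).length,
        word K ((l.take i).take j) (l.take i)[j] ((l.take i).drop (j + 1)) ⊗ₜ
          word K (l.drop i) v r := by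
  simp only [comul₂, LinearMap.comp_apply, word, TensorProduct.map_tmul, LinearMap.id_apply,
    deconc_monomial, map_sum, pointings_monomial, TensorProduct.sum_tmul, LinearEquiv.coe_coe,
    TensorProduct.assoc_tmul]

variable (V)

/-- The projection `TV ⊗ V ⊗ TV → K ⊗ V ⊗ K = V` onto the words of length one. -/
def toLetters : Diass K V →ₗ[K] V :=
  (TensorProduct.lid K V).toLinearMap ∘ₗ
    TensorProduct.map (TensorAlgebra.algebraMapInv (R := K) (M := V)).toLinearMap
      ((TensorProduct.rid K V).toLinearMap ∘ₗ
        TensorProduct.map LinearMap.id (TensorAlgebra.algebraMapInv (R := K) (M := V)).toLinearMap)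

variable {V}

theorem toLetters_word_nil (v : V) : toLetters K V (word K [] v []) = v := by
  simp [toLetters, word, monomial]

theorem toLetters_word_of_ne (l : List V) (v : V) (r : List V) (h : l ≠ [] ∨ r ≠ []) :
    toLetters K V (word K l v r) = 0 := by
  rcases h with h | h <;> obtain ⟨x, t, rfl⟩ := List.exists_cons_of_ne_nil h <;>
    simp [toLetters, word, monomial, TensorAlgebra.algebraMapInv]

variable {K}

/-- The component of degree `p` of `Diass^c(V)`: it is spanned by the words in homogeneous letters
whose degrees add up to `p`. -/
def diassDegree (𝒱 : ℤ → Submodule K V) (p : ℤ) : Submodule K (Diass K V) :=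
  Submodule.span K {x | ∃ (n : ℕ) (a : Fin n → V) (d : Fin n → ℤ) (r : Fin n),
    (∀ t, a t ∈ 𝒱 (d t)) ∧ ∑ t, d t = p ∧ x = pointedWord K a r}

/-- The linear map `x ↦ (-1)^{e |x|} x` of the graded vector space `Diass^c(V)`. -/
def diassSignMap (𝒱 : ℤ → Submodule K V) [DirectSum.Decomposition 𝒱] (e : ℤ) :
    Diass K V →ₗ[K] Diass K V :=
  let T := (TensorAlgebra.lift K (TensorAlgebra.ι K ∘ₗ signMap 𝒱 e)).toLinearMap
  TensorProduct.map T (TensorProduct.map (signMap 𝒱 e) T)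

theorem diassSignMap_apply (𝒱 : ℤ → Submodule K V) [DirectSum.Decomposition 𝒱] (e p : ℤ)
    {x : Diass K V} (hx : x ∈ diassDegree 𝒱 p) :
    diassSignMap 𝒱 e x = (-1 : K) ^ (e * p) • x := by
  have hT : ∀ L : List (V × ℤ), (∀ y ∈ L, y.1 ∈ 𝒱 y.2) →
      TensorAlgebra.lift K (TensorAlgebra.ι K ∘ₗ signMap 𝒱 e) (monomial K (L.map Prod.fst)) =
        (-1 : K) ^ (e * (L.map Prod.snd).sum) • monomial K (L.map Prod.fst) := by
    intro L
    induction L with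
    | nil => intro _; simp [monomial]
    | cons y L ih =>
      intro hL
      have h₁ := ih fun z hz => hL z (List.mem_cons_of_mem _ hz)
      have h₂ := signMap_apply 𝒱 e (hL y List.mem_cons_self)
      have h₃ : monomial K ((y :: L).map Prod.fst) =
          TensorAlgebra.ι K y.1 * monomial K (L.map Prod.fst) := by simp [monomial]
      rw [h₃, map_mul, h₁, TensorAlgebra.lift_ι_apply, LinearMap.comp_apply, h₂, map_smul,
        smul_mul_smul_comm, List.map_cons, List.sum_cons, mul_add,
        zpow_add₀ (neg_ne_zero.2 one_ne_zero)]
  induction hx using Submodule.span_induction with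
  | zero => simp
  | add x y _ _ hx hy => rw [map_add, hx, hy, smul_add]
  | smul c x _ hx => rw [map_smul, hx, smul_comm]
  | mem x hx =>
    obtain ⟨n, a, d, r, ha, rfl, rfl⟩ := hx
    set L := List.ofFn fun t => (a t, d t) with hL
    have hmem : ∀ y ∈ L, y.1 ∈ 𝒱 y.2 := by
      intro y hy
      obtain ⟨t, rfl⟩ := (List.mem_ofFn' _ _).1 hy
      exact ha t
    have hfst : List.ofFn a = L.map Prod.fst := by simp [hL, List.map_ofFn, Function.comp_def]
    have hsnd : List.ofFn d = L.map Prod.snd := by simp [hL, List.map_ofFn, Function.comp_def]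
    have hsum : ∑ t, d t = ((L.take r).map Prod.snd).sum + (d r +
        ((L.drop (r + 1)).map Prod.snd).sum) := by
      have hlen : (r : ℕ) < (List.ofFn d).length := by simp
      rw [← List.sum_ofFn, ← List.sum_take_add_sum_drop (List.ofFn d) r,
        List.drop_eq_getElem_cons hlen, List.sum_cons, List.getElem_ofFn, hsnd, List.map_take,
        List.map_drop]
    have h₁ := hT (L.take r) fun y hy => hmem y (List.mem_of_mem_take hy)
    have h₂ := hT (L.drop (r + 1)) fun y hy => hmem y (List.mem_of_mem_drop hy)
    have h₃ := signMap_apply 𝒱 e (ha r)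
    have h0 : (-1 : K) ≠ 0 := neg_ne_zero.2 one_ne_zero
    simp only [diassSignMap, pointedWord, word, TensorProduct.map_tmul, AlgHom.toLinearMap_apply,
      hfst, ← List.map_take, ← List.map_drop, h₁, h₂, h₃, ← TensorProduct.smul_tmul',
      TensorProduct.tmul_smul, smul_smul, hsum, mul_add, zpow_add₀ h0]
    congr 1
    ring

/-- `d` is a coderivation of degree `e` of `Diass^c(V)`: it raises degrees by `e`, and
`△ ∘ d = (id ⊗ d + d ⊗ id) ∘ △` for `△ = △₁` and for `△ = △₂`, with the Koszul sign rule
`(id ⊗ d)(x ⊗ y) = (-1)^{e |x|} x ⊗ d(y)`. -/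
structure IsCoderivation (𝒱 : ℤ → Submodule K V) [DirectSum.Decomposition 𝒱] (e : ℤ)
    (d : Diass K V →ₗ[K] Diass K V) : Prop where
  degree : ∀ (p : ℤ) (x : Diass K V), x ∈ diassDegree 𝒱 p → d x ∈ diassDegree 𝒱 (p + e)
  comul₁_comp : comul₁ K V ∘ₗ d =
    (TensorProduct.map (diassSignMap 𝒱 e) d + TensorProduct.map d LinearMap.id) ∘ₗ comul₁ K V
  comul₂_comp : comul₂ K V ∘ₗ d =
    (TensorProduct.map (diassSignMap 𝒱 e) d + TensorProduct.map d LinearMap.id) ∘ₗ comul₂ K V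

end Diass

end DendInfty

end

/-! `Diass^c(V)` behaves as a cofree object: a coderivation `D` is determined by its corestriction
`B = π ∘ D`, and every `B` of degree -1 occurs. The coderivation with corestriction `B` is a sum
over blocks of consecutive letters. A block is replaced by one letter, and the letters in front of
it receive the Koszul sign. If the block contains the distinguished letter, it becomes `B` of the
pointed block, and the new letter is distinguished. Otherwise it becomes the sum of `B` over all
pointings of the block. This sum is forced, because a coproduct re-points the half that loses the
distinguished letter; it is also the source of `[1] + ⋯ + [n]` in `R_i`. The map is `contractDiass`.
Its compatibility with the coproducts (`comul₁_contractDiass`, `comul₂_contractDiass`) reduces to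
its compatibility with deconcatenation and with pointing. Uniqueness
(`eq_zero_of_toLetters_comp_eq_zero`) is an induction on the length of words: an element killed by
both coproducts and by `π` is zero.

Since `D` is odd, `D ∘ D` satisfies a coderivation identity again, with the square of the sign map.
Hence `D ∘ D = 0` if and only if `B ∘ D = 0` (`IsCoderivation.comp_self_eq_zero_iff`). On a pointed
word, `B ∘ D` is a sum over blocks in which `R_0` records the new position of the distinguished
letter and `R_i` the pointing of the block (`contractDiass_pointedWord`). Once `B` is written as `s
∘ μ ∘ (s⁻¹)^{⊗ k}`, the sign of each term differs from the `Dend_∞` sign by a factor that does not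
depend on the block (`corestriction_replaceBlock`), so `B ∘ D = 0` is the family of `Dend_∞`
identities. As `μ ↦ B` is invertible, this gives the bijection. -/

open scoped TensorProduct

noncomputable section

namespace DendInfty

/-! ### Sums over the splittings and the pointings of a list. -/

section ListSums

variable {α M N : Type*} [AddCommMonoid M] [AddCommMonoid N]

/-- The sum of `g x y` over all the ways of writing a list as `x ++ y`. -/
def splitSum (g : List α → List α → M) : List α → M
  | [] => g [] []
  | a :: w => g [] (a :: w) + splitSum (fun x y => g (a :: x) y) w

/-- The sum of `h x v y` over all the ways of writing a list as `x ++ v :: y`. -/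
def pointSum (h : List α → α → List α → M) : List α → M
  | [] => 0
  | a :: w => h [] a w + pointSum (fun x v y => h (a :: x) v y) w

@[simp] theorem splitSum_nil (g : List α → List α → M) : splitSum g [] = g [] [] := rfl

@[simp] theorem splitSum_cons (g : List α → List α → M) (a : α) (w : List α) :
    splitSum g (a :: w) = g [] (a :: w) + splitSum (fun x y => g (a :: x) y) w := rfl

@[simp] theorem pointSum_nil (h : List α → α → List α → M) : pointSum h [] = 0 := rfl

@[simp] theorem pointSum_cons (h : List α → α → List α → M) (a : α) (w : List α) :
    pointSum h (a :: w) = h [] a w + pointSum (fun x v y => h (a :: x) v y) w := rfl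

theorem splitSum_add (g g' : List α → List α → M) (w : List α) :
    splitSum (fun x y => g x y + g' x y) w = splitSum g w + splitSum g' w := by
  induction w generalizing g g' with
  | nil => rfl
  | cons a w ih => simp only [splitSum_cons, ih]; exact add_add_add_comm _ _ _ _

theorem pointSum_add (g g' : List α → α → List α → M) (w : List α) :
    pointSum (fun x v y => g x v y + g' x v y) w = pointSum g w + pointSum g' w := by
  induction w generalizing g g' with
  | nil => simp
  | cons a w ih => simp only [pointSum_cons, ih]; exact add_add_add_comm _ _ _ _

theorem map_splitSum {F : Type*} [FunLike F M N] [AddMonoidHomClass F M N] (f : F)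
    (g : List α → List α → M) (w : List α) :
    f (splitSum g w) = splitSum (fun x y => f (g x y)) w := by
  induction w generalizing g with
  | nil => rfl
  | cons a w ih => simp only [splitSum_cons, map_add, ih]

theorem map_pointSum {F : Type*} [FunLike F M N] [AddMonoidHomClass F M N] (f : F)
    (h : List α → α → List α → M) (w : List α) :
    f (pointSum h w) = pointSum (fun x v y => f (h x v y)) w := by
  induction w generalizing h with
  | nil => simp
  | cons a w ih => simp only [pointSum_cons, map_add, ih]

/-- Coassociativity of deconcatenation: both sides run over the decompositions of `w` into three
consecutive pieces. -/
theorem splitSum_splitSum (g : List α → List α → List α → M) (w : List α) :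
    splitSum (fun x y => splitSum (fun x₁ x₂ => g x₁ x₂ y) x) w =
      splitSum (fun x y => splitSum (fun y₁ y₂ => g x y₁ y₂) y) w := by
  induction w generalizing g with
  | nil => rfl
  | cons a w ih =>
    simp only [splitSum_cons, splitSum_nil, splitSum_add, ih]
    abel

theorem splitSum_comm {β : Type*} (g : List α → List α → List β → List β → M) (w : List α)
    (w' : List β) :
    splitSum (fun x y => splitSum (fun x' y' => g x y x' y') w') w =
      splitSum (fun x' y' => splitSum (fun x y => g x y x' y') w) w' := by
  induction w generalizing g with
  | nil => rfl
  | cons a w ih => simp only [splitSum_cons, splitSum_add, ih]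

/-- Cutting to the left of a chosen letter is the same as cutting first and choosing the letter in
the right half. The mirror image follows. -/
theorem pointSum_splitSum_left (g : List α → List α → α → List α → M) (w : List α) :
    pointSum (fun x v y => splitSum (fun x₁ x₂ => g x₁ x₂ v y) x) w =
      splitSum (fun x y => pointSum (fun y₁ v y₂ => g x y₁ v y₂) y) w := by
  induction w generalizing g with
  | nil => rfl
  | cons a w ih =>
    simp only [splitSum_cons, splitSum_nil, pointSum_cons, pointSum_add, ih]
    abel

theorem pointSum_splitSum_right (g : List α → α → List α → List α → M) (w : List α) :
    pointSum (fun x v y => splitSum (fun y₁ y₂ => g x v y₁ y₂) y) w =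
      splitSum (fun x y => pointSum (fun x₁ v x₂ => g x₁ v x₂ y) x) w := by
  induction w generalizing g with
  | nil => rfl
  | cons a w ih =>
    simp only [splitSum_cons, pointSum_nil, pointSum_cons, splitSum_add, ih, zero_add]

theorem splitSum_map {β : Type*} (f : β → α) (g : List α → List α → M) (w : List β) :
    splitSum g (w.map f) = splitSum (fun x y => g (x.map f) (y.map f)) w := by
  induction w generalizing g with
  | nil => rfl
  | cons a w ih => simp only [List.map_cons, splitSum_cons, ih, List.map_nil]

theorem pointSum_map {β : Type*} (f : β → α) (h : List α → α → List α → M) (w : List β) :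
    pointSum h (w.map f) = pointSum (fun x v y => h (x.map f) (f v) (y.map f)) w := by
  induction w generalizing h with
  | nil => rfl
  | cons a w ih => simp only [List.map_cons, pointSum_cons, ih, List.map_nil]

/-- Serves for counit arguments, where only the cut with an empty left half survives. -/
theorem splitSum_eq_of_left (g : List α → List α → M) (w : List α)
    (h : ∀ a x y, g (a :: x) y = 0) : splitSum g w = g [] w := by
  cases w with
  | nil => rfl
  | cons a w =>
    have h₀ : ∀ w : List α, splitSum (fun _ _ => (0 : M)) w = 0 := fun w => by
      induction w with
      | nil => rfl
      | cons a w ih => simp [ih]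
    simp [h, h₀]

theorem splitSum_eq_of_right (g : List α → List α → M) (w : List α)
    (h : ∀ x a y, g x (a :: y) = 0) : splitSum g w = g w [] := by
  induction w generalizing g with
  | nil => rfl
  | cons a w ih => rw [splitSum_cons, h, zero_add, ih _ fun x => h _]

theorem splitSum_eq_sum_range (g : List α → List α → M) (w : List α) :
    splitSum g w = ∑ i ∈ Finset.range (w.length + 1), g (w.take i) (w.drop i) := by
  induction w generalizing g with
  | nil => simp
  | cons a w ih =>
    rw [splitSum_cons, ih, List.length_cons, Finset.sum_range_succ' _ (w.length + 1), add_comm]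
    simp

theorem pointSum_eq_sum (h : List α → α → List α → M) (w : List α) :
    pointSum h w = ∑ i : Fin w.length, h (w.take i) w[i] (w.drop (i + 1)) := by
  induction w generalizing h with
  | nil => simp
  | cons a w ih =>
    rw [pointSum_cons, ih]
    refine Eq.symm ((Fin.sum_univ_succ _).trans ?_)
    simp

section Tensor

variable {R P Q : Type*} [CommSemiring R] [AddCommMonoid P] [AddCommMonoid Q] [Module R P]
  [Module R Q]

theorem tmul_splitSum (p : P) (g : List α → List α → Q) (w : List α) :
    p ⊗ₜ[R] splitSum g w = splitSum (fun x y => p ⊗ₜ[R] g x y) w :=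
  map_splitSum (TensorProduct.mk R P Q p) g w

theorem splitSum_tmul (g : List α → List α → P) (w : List α) (q : Q) :
    splitSum g w ⊗ₜ[R] q = splitSum (fun x y => g x y ⊗ₜ[R] q) w :=
  map_splitSum ((TensorProduct.mk R P Q).flip q) g w

theorem tmul_pointSum (p : P) (h : List α → α → List α → Q) (w : List α) :
    p ⊗ₜ[R] pointSum h w = pointSum (fun x v y => p ⊗ₜ[R] h x v y) w :=
  map_pointSum (TensorProduct.mk R P Q p) h w

theorem pointSum_tmul (h : List α → α → List α → P) (w : List α) (q : Q) :
    pointSum h w ⊗ₜ[R] q = pointSum (fun x v y => h x v y ⊗ₜ[R] q) w :=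
  map_pointSum ((TensorProduct.mk R P Q).flip q) h w

end Tensor

end ListSums

/-! ### Monomials and words as spanning sets. -/

section Words

variable {K V W : Type*} [Field K] [AddCommGroup V] [Module K V] [AddCommMonoid W] [Module K W]

theorem monomial_nil : monomial K ([] : List V) = 1 := rfl

theorem monomial_cons (v : V) (l : List V) :
    monomial K (v :: l) = TensorAlgebra.ι K v * monomial K l := by
  simp [monomial]

theorem monomial_append (l r : List V) :
    monomial K (l ++ r) = monomial K l * monomial K r := by
  simp [monomial]

theorem span_monomial : Submodule.span K (Set.range (monomial K (V := V))) = ⊤ := by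
  rw [eq_top_iff]
  rintro x -
  induction x using TensorAlgebra.induction with
  | algebraMap c =>
    rw [Algebra.algebraMap_eq_smul_one]
    exact Submodule.smul_mem _ _ (Submodule.subset_span ⟨[], rfl⟩)
  | ι v => exact Submodule.subset_span ⟨[v], by simp [monomial]⟩
  | add x y hx hy => exact add_mem hx hy
  | mul x y hx hy =>
    have := Submodule.mul_mem_mul hx hy
    rw [Submodule.span_mul_span] at this
    refine Submodule.span_mono ?_ this
    rintro _ ⟨_, ⟨l, rfl⟩, _, ⟨r, rfl⟩, rfl⟩
    exact ⟨l ++ r, monomial_append l r⟩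

/-- Linear maps on the tensor algebra that agree on monomials are equal. -/
theorem hom_ext_monomial {f g : TensorAlgebra K V →ₗ[K] W}
    (h : ∀ l, f (monomial K l) = g (monomial K l)) : f = g := by
  refine LinearMap.ext_on_range span_monomial h

theorem span_word :
    Submodule.span K {x : Diass K V | ∃ l v r, x = word K l v r} = ⊤ := by
  rw [eq_top_iff]
  rintro x -
  induction x using TensorProduct.induction_on with
  | zero => exact zero_mem _
  | add x y hx hy => exact add_mem hx hy
  | tmul t z =>
    induction z using TensorProduct.induction_on with
    | zero => simp
    | add x y hx hy => rw [TensorProduct.tmul_add]; exact add_mem hx hy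
    | tmul v s =>
      have ht : t ∈ Submodule.span K (Set.range (monomial K (V := V))) := by
        rw [span_monomial]; trivial
      have hs : s ∈ Submodule.span K (Set.range (monomial K (V := V))) := by
        rw [span_monomial]; trivial
      induction ht using Submodule.span_induction with
      | zero => simp
      | add x y _ _ hx hy => rw [TensorProduct.add_tmul]; exact add_mem hx hy
      | smul c x _ hx => rw [← TensorProduct.smul_tmul']; exact Submodule.smul_mem _ _ hx
      | mem x hx =>
        obtain ⟨l, rfl⟩ := hx
        induction hs using Submodule.span_induction with
        | zero => simp
        | add x y _ _ hx hy => simp only [TensorProduct.tmul_add]; exact add_mem hx hy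
        | smul c x _ hx => simp only [TensorProduct.tmul_smul]; exact Submodule.smul_mem _ _ hx
        | mem x hx =>
          obtain ⟨r, rfl⟩ := hx
          exact Submodule.subset_span ⟨l, v, r, rfl⟩

/-- Linear maps on `TV ⊗ V ⊗ TV` that agree on words are equal. -/
theorem hom_ext_word {f g : Diass K V →ₗ[K] W}
    (h : ∀ l v r, f (word K l v r) = g (word K l v r)) : f = g := by
  refine LinearMap.ext_on span_word ?_
  rintro _ ⟨l, v, r, rfl⟩
  exact h l v r

theorem deconc_monomial_eq_splitSum (w : List V) :
    deconc K V (monomial K w) = splitSum (fun x y => monomial K x ⊗ₜ monomial K y) w := by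
  rw [deconc_monomial, splitSum_eq_sum_range]

theorem pointings_monomial_eq_pointSum (w : List V) :
    pointings K V (monomial K w) = pointSum (word K) w := by
  rw [pointings_monomial, pointSum_eq_sum]

/-- A cut falls either in front of the first letter or after it. This recursion and the next one
drive the later inductions on the first letter. -/
theorem deconc_ι_mul (a : V) (x : TensorAlgebra K V) :
    deconc K V (TensorAlgebra.ι K a * x) = 1 ⊗ₜ (TensorAlgebra.ι K a * x) +
      TensorProduct.map (LinearMap.mulLeft K (TensorAlgebra.ι K a)) LinearMap.id
        (deconc K V x) := by
  let L := LinearMap.mulLeft K (TensorAlgebra.ι K a)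
  have : deconc K V ∘ₗ L = TensorProduct.mk K _ _ 1 ∘ₗ L +
      TensorProduct.map L LinearMap.id ∘ₗ deconc K V := by
    refine hom_ext_monomial fun w => ?_
    simp only [L, LinearMap.comp_apply, LinearMap.add_apply, LinearMap.mulLeft_apply,
      ← monomial_cons, deconc_monomial_eq_splitSum, splitSum_cons, map_splitSum,
      TensorProduct.map_tmul, TensorProduct.mk_apply, LinearMap.id_apply, monomial_nil]
  exact LinearMap.congr_fun this x

theorem pointings_ι_mul (a : V) (x : TensorAlgebra K V) :
    pointings K V (TensorAlgebra.ι K a * x) = 1 ⊗ₜ (a ⊗ₜ x) +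
      TensorProduct.map (LinearMap.mulLeft K (TensorAlgebra.ι K a)) LinearMap.id
        (pointings K V x) := by
  let L := LinearMap.mulLeft K (TensorAlgebra.ι K a)
  have : pointings K V ∘ₗ L = TensorProduct.mk K _ _ 1 ∘ₗ TensorProduct.mk K _ _ a +
      TensorProduct.map L LinearMap.id ∘ₗ pointings K V := by
    refine hom_ext_monomial fun w => ?_
    simp only [L, LinearMap.comp_apply, LinearMap.add_apply, LinearMap.mulLeft_apply,
      ← monomial_cons, pointings_monomial_eq_pointSum, pointSum_cons, map_pointSum,
      TensorProduct.map_tmul, TensorProduct.mk_apply, LinearMap.id_apply, monomial_nil, word]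
  exact LinearMap.congr_fun this x

end Words

/-! ### Coderivations of `Diass^c(V)` with given corestriction: existence. -/

section Cofree

variable {K V : Type*} [Field K] [AddCommGroup V] [Module K V]

/-- The algebra endomorphism of `TV` that extends a linear map of the letters. -/
def tensorMap (σ : V →ₗ[K] V) : TensorAlgebra K V →ₐ[K] TensorAlgebra K V :=
  TensorAlgebra.lift K (TensorAlgebra.ι K ∘ₗ σ)

/-- The endomorphism of `TV ⊗ V ⊗ TV` that applies a linear map to every letter. -/
def diassMap (σ : V →ₗ[K] V) : Diass K V →ₗ[K] Diass K V :=
  TensorProduct.map (tensorMap σ).toLinearMap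
    (TensorProduct.map σ (tensorMap σ).toLinearMap)

@[simp] theorem tensorMap_ι_mul (σ : V →ₗ[K] V) (a : V) (x : TensorAlgebra K V) :
    tensorMap σ (TensorAlgebra.ι K a * x) = TensorAlgebra.ι K (σ a) * tensorMap σ x := by
  simp [tensorMap]

theorem tensorMap_monomial (σ : V →ₗ[K] V) (w : List V) :
    tensorMap σ (monomial K w) = monomial K (w.map σ) := by
  induction w with
  | nil => simp [monomial]
  | cons a w ih => rw [monomial_cons, tensorMap_ι_mul, ih, List.map_cons, monomial_cons]

theorem diassMap_word (σ : V →ₗ[K] V) (l : List V) (v : V) (r : List V) :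
    diassMap σ (word K l v r) = word K (l.map σ) (σ v) (r.map σ) := by
  simp [diassMap, word, tensorMap_monomial]

theorem deconc_tensorMap (σ : V →ₗ[K] V) (x : TensorAlgebra K V) :
    deconc K V (tensorMap σ x) =
      TensorProduct.map (tensorMap σ).toLinearMap (tensorMap σ).toLinearMap (deconc K V x) := by
  suffices h : deconc K V ∘ₗ (tensorMap σ).toLinearMap =
      TensorProduct.map (tensorMap σ).toLinearMap (tensorMap σ).toLinearMap ∘ₗ deconc K V from
    LinearMap.congr_fun h x
  refine hom_ext_monomial fun w => ?_
  simp only [LinearMap.comp_apply, AlgHom.toLinearMap_apply, tensorMap_monomial,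
    deconc_monomial_eq_splitSum, map_splitSum, TensorProduct.map_tmul, splitSum_map]

theorem pointings_tensorMap (σ : V →ₗ[K] V) (x : TensorAlgebra K V) :
    pointings K V (tensorMap σ x) = diassMap σ (pointings K V x) := by
  suffices h : pointings K V ∘ₗ (tensorMap σ).toLinearMap = diassMap σ ∘ₗ pointings K V from
    LinearMap.congr_fun h x
  refine hom_ext_monomial fun w => ?_
  simp only [LinearMap.comp_apply, AlgHom.toLinearMap_apply, tensorMap_monomial,
    pointings_monomial_eq_pointSum, map_pointSum, diassMap_word, pointSum_map]

/-- The sum of `B` over all the choices of a distinguished letter. -/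
def totalContraction (B : Diass K V →ₗ[K] V) : TensorAlgebra K V →ₗ[K] V :=
  B ∘ₗ pointings K V

/-- `w ↦ ∑ B(x) y` over the deconcatenations of `w`. -/
def contractInitial (B : Diass K V →ₗ[K] V) : TensorAlgebra K V →ₗ[K] TensorAlgebra K V :=
  LinearMap.mul' K _ ∘ₗ
    TensorProduct.map (TensorAlgebra.ι K ∘ₗ totalContraction B) LinearMap.id ∘ₗ deconc K V

/-- `w ↦ ∑ σ(x) B(y) z` over the iterated deconcatenations of `w`: the `σ`-coderivation of the
tensor coalgebra with corestriction `totalContraction B`. -/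
def contractTensor (σ : V →ₗ[K] V) (B : Diass K V →ₗ[K] V) :
    TensorAlgebra K V →ₗ[K] TensorAlgebra K V :=
  LinearMap.mul' K _ ∘ₗ
    TensorProduct.map (tensorMap σ).toLinearMap (contractInitial B) ∘ₗ deconc K V

/-- `l ⊗ v ⊗ r ↦ ∑ B(l ⊗ v ⊗ x) ⊗ y` over the deconcatenations of `r`. -/
def contractPointed (B : Diass K V →ₗ[K] V) : Diass K V →ₗ[K] V ⊗[K] TensorAlgebra K V :=
  TensorProduct.map B LinearMap.id ∘ₗ
    (TensorProduct.assoc K (TensorAlgebra K V) (V ⊗[K] TensorAlgebra K V)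
      (TensorAlgebra K V)).symm.toLinearMap ∘ₗ
    TensorProduct.map LinearMap.id
      ((TensorProduct.assoc K V (TensorAlgebra K V) (TensorAlgebra K V)).symm.toLinearMap ∘ₗ
        TensorProduct.map LinearMap.id (deconc K V))

/-- The terms of `contractDiass` that contract a block containing the distinguished letter. -/
def contractMiddle (σ : V →ₗ[K] V) (B : Diass K V →ₗ[K] V) : Diass K V →ₗ[K] Diass K V :=
  TensorProduct.map (tensorMap σ).toLinearMap (contractPointed B) ∘ₗ
    (TensorProduct.assoc K (TensorAlgebra K V) (TensorAlgebra K V)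
      (V ⊗[K] TensorAlgebra K V)).toLinearMap ∘ₗ
    TensorProduct.map (deconc K V) LinearMap.id

/-- The `σ`-coderivation of `Diass^c(V)` with corestriction `B`. -/
def contractDiass (σ : V →ₗ[K] V) (B : Diass K V →ₗ[K] V) : Diass K V →ₗ[K] Diass K V :=
  TensorProduct.map (contractTensor σ B) LinearMap.id + contractMiddle σ B +
    TensorProduct.map (tensorMap σ).toLinearMap (TensorProduct.map σ (contractTensor σ B))

/-- The terms of `contractDiass` that contract a block starting with the first letter. -/
def contractDiassInitial (B : Diass K V →ₗ[K] V) : Diass K V →ₗ[K] Diass K V :=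
  TensorProduct.map (contractInitial B) LinearMap.id +
    TensorProduct.mk K (TensorAlgebra K V) (V ⊗[K] TensorAlgebra K V) 1 ∘ₗ contractPointed B

variable (σ : V →ₗ[K] V) (B : Diass K V →ₗ[K] V)

@[simp] theorem totalContraction_one : totalContraction B 1 = 0 := by
  have := pointings_monomial_eq_pointSum (K := K) ([] : List V)
  rw [monomial_nil, pointSum_nil] at this
  simp [totalContraction, this]

@[simp] theorem deconc_one : deconc K V 1 = 1 ⊗ₜ 1 := by
  simpa [monomial_nil] using deconc_monomial_eq_splitSum (K := K) ([] : List V)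

@[simp] theorem pointings_one : pointings K V 1 = 0 := by
  simpa [monomial_nil] using pointings_monomial_eq_pointSum (K := K) ([] : List V)

@[simp] theorem contractInitial_one : contractInitial B 1 = 0 := by
  simp [contractInitial]

@[simp] theorem contractTensor_one : contractTensor σ B 1 = 0 := by
  simp [contractTensor]

theorem contractInitial_monomial (w : List V) :
    contractInitial B (monomial K w) = splitSum (fun x y =>
      TensorAlgebra.ι K (totalContraction B (monomial K x)) * monomial K y) w := by
  simp [contractInitial, deconc_monomial_eq_splitSum, map_splitSum]

theorem contractTensor_monomial (w : List V) :
    contractTensor σ B (monomial K w) = splitSum (fun x y =>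
      monomial K (x.map σ) * contractInitial B (monomial K y)) w := by
  simp [contractTensor, deconc_monomial_eq_splitSum, map_splitSum, tensorMap_monomial]

/-- The contracted block either starts at the first letter, or leaves this letter in front of it,
where `σ` acts. -/
theorem contractTensor_ι_mul (a : V) (x : TensorAlgebra K V) :
    contractTensor σ B (TensorAlgebra.ι K a * x) =
      contractInitial B (TensorAlgebra.ι K a * x) +
        TensorAlgebra.ι K (σ a) * contractTensor σ B x := by
  simp only [contractTensor, LinearMap.comp_apply, deconc_ι_mul, map_add, TensorProduct.map_tmul,
    AlgHom.toLinearMap_apply, map_one, LinearMap.mul'_apply, one_mul]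
  congr 1
  generalize deconc K V x = z
  induction z using TensorProduct.induction_on with
  | zero => simp
  | add x y hx hy => simp only [map_add, hx, hy, mul_add]
  | tmul x y => simp [mul_assoc]

theorem contractPointed_word (l : List V) (v : V) (r : List V) :
    contractPointed B (word K l v r) =
      splitSum (fun x y => B (word K l v x) ⊗ₜ monomial K y) r := by
  simp only [contractPointed, word, LinearMap.comp_apply, TensorProduct.map_tmul,
    LinearMap.id_apply, deconc_monomial_eq_splitSum, tmul_splitSum, map_splitSum,
    LinearEquiv.coe_coe, TensorProduct.assoc_symm_tmul]

theorem contractMiddle_word (l : List V) (v : V) (r : List V) :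
    contractMiddle σ B (word K l v r) =
      splitSum (fun x y => monomial K (x.map σ) ⊗ₜ contractPointed B (word K y v r)) l := by
  simp only [contractMiddle, word, LinearMap.comp_apply, TensorProduct.map_tmul,
    LinearMap.id_apply, deconc_monomial_eq_splitSum, splitSum_tmul, map_splitSum,
    LinearEquiv.coe_coe, TensorProduct.assoc_tmul, AlgHom.toLinearMap_apply, tensorMap_monomial]

theorem contractDiass_word (l : List V) (v : V) (r : List V) :
    contractDiass σ B (word K l v r) =
      contractTensor σ B (monomial K l) ⊗ₜ (v ⊗ₜ monomial K r) +
      splitSum (fun x y => monomial K (x.map σ) ⊗ₜ contractPointed B (word K y v r)) l +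
      monomial K (l.map σ) ⊗ₜ (σ v ⊗ₜ contractTensor σ B (monomial K r)) := by
  rw [contractDiass, LinearMap.add_apply, LinearMap.add_apply, contractMiddle_word]
  simp only [word, TensorProduct.map_tmul, AlgHom.toLinearMap_apply, tensorMap_monomial,
    LinearMap.id_apply]

theorem contractDiassInitial_word (l : List V) (v : V) (r : List V) :
    contractDiassInitial B (word K l v r) =
      contractInitial B (monomial K l) ⊗ₜ (v ⊗ₜ monomial K r) +
        1 ⊗ₜ contractPointed B (word K l v r) := by
  rfl

theorem contractDiass_word_nil (v : V) (r : List V) :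
    contractDiass σ B (word K [] v r) = contractDiassInitial B (word K [] v r) +
      1 ⊗ₜ (σ v ⊗ₜ contractTensor σ B (monomial K r)) := by
  rw [contractDiass_word, contractDiassInitial_word]
  simp [monomial_nil]

theorem contractDiass_word_cons (a : V) (l : List V) (v : V) (r : List V) :
    contractDiass σ B (word K (a :: l) v r) =
      TensorProduct.map (LinearMap.mulLeft K (TensorAlgebra.ι K (σ a))) LinearMap.id
        (contractDiass σ B (word K l v r)) + contractDiassInitial B (word K (a :: l) v r) := by
  rw [contractDiass_word, contractDiass_word, contractDiassInitial_word]
  simp only [splitSum_cons, List.map_cons, monomial_cons, map_add, map_splitSum,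
    TensorProduct.map_tmul, LinearMap.mulLeft_apply, LinearMap.id_apply, contractTensor_ι_mul,
    TensorProduct.add_tmul, List.map_nil, monomial_nil]
  abel

/-- After the contraction of an initial block, the chosen letter is either the new one or lies
behind it. In the first case, the sum over pointings inside `totalContraction` is exactly the sum
over the pointings of the original word that fall in the block. -/
theorem pointings_contractInitial (x : TensorAlgebra K V) :
    pointings K V (contractInitial B x) = contractDiassInitial B (pointings K V x) := by
  suffices h : pointings K V ∘ₗ contractInitial B = contractDiassInitial B ∘ₗ pointings K V from
    LinearMap.congr_fun h x
  refine hom_ext_monomial fun w => ?_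
  simp only [LinearMap.comp_apply, contractInitial_monomial, map_splitSum, pointings_ι_mul,
    pointings_monomial_eq_pointSum, map_pointSum, contractDiassInitial_word,
    contractPointed_word, splitSum_add, pointSum_add, splitSum_tmul, tmul_splitSum,
    pointSum_splitSum_left (fun x₁ x₂ v y => (TensorAlgebra.ι K (totalContraction B
      (monomial K x₁)) * monomial K x₂) ⊗ₜ[K] (v ⊗ₜ[K] monomial K y)),
    pointSum_splitSum_right (fun x v y₁ y₂ => (1 : TensorAlgebra K V) ⊗ₜ[K]
      (B (word K x v y₁) ⊗ₜ[K] monomial K y₂))]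
  rw [add_comm]
  congr 1
  simp only [totalContraction, LinearMap.comp_apply, pointings_monomial_eq_pointSum,
    map_pointSum, tmul_pointSum, pointSum_tmul]

theorem deconc_contractInitial (x : TensorAlgebra K V) :
    deconc K V (contractInitial B x) = 1 ⊗ₜ contractInitial B x +
      TensorProduct.map (contractInitial B) LinearMap.id (deconc K V x) := by
  suffices h : deconc K V ∘ₗ contractInitial B = TensorProduct.mk K _ _ 1 ∘ₗ contractInitial B +
      TensorProduct.map (contractInitial B) LinearMap.id ∘ₗ deconc K V from
    LinearMap.congr_fun h x
  refine hom_ext_monomial fun w => ?_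
  simp only [LinearMap.comp_apply, LinearMap.add_apply, TensorProduct.mk_apply,
    deconc_monomial_eq_splitSum, contractInitial_monomial, map_splitSum, deconc_ι_mul,
    splitSum_add, TensorProduct.map_tmul, LinearMap.id_apply, splitSum_tmul,
    LinearMap.mulLeft_apply]
  rw [splitSum_splitSum (fun x₁ x₂ y => (TensorAlgebra.ι K (totalContraction B
      (monomial K x₁)) * monomial K x₂) ⊗ₜ[K] monomial K y)]

/-- A cut never separates a contracted letter, so the block lies wholly in one half. If it lies in
the right half, `σ` has passed over the whole left half. -/
theorem deconc_contractTensor (x : TensorAlgebra K V) :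
    deconc K V (contractTensor σ B x) =
      TensorProduct.map (contractTensor σ B) LinearMap.id (deconc K V x) +
      TensorProduct.map (tensorMap σ).toLinearMap (contractTensor σ B) (deconc K V x) := by
  suffices h : deconc K V ∘ₗ contractTensor σ B =
      TensorProduct.map (contractTensor σ B) LinearMap.id ∘ₗ deconc K V +
      TensorProduct.map (tensorMap σ).toLinearMap (contractTensor σ B) ∘ₗ deconc K V from
    LinearMap.congr_fun h x
  refine hom_ext_monomial fun w => ?_
  simp only [LinearMap.comp_apply, LinearMap.add_apply]
  induction w with
  | nil => simp [monomial_nil]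
  | cons a w ih =>
    simp only [monomial_cons, contractTensor_ι_mul, map_add, deconc_ι_mul, ih,
      deconc_contractInitial, TensorProduct.map_tmul, contractTensor_one, contractInitial_one,
      TensorProduct.zero_tmul, zero_add, AlgHom.toLinearMap_apply, map_one, LinearMap.id_apply,
      TensorProduct.tmul_add]
    generalize deconc K V (monomial K w) = z
    -- These are the cuts behind the first letter `a`. The identity is the recursion of
    -- `contractTensor` in the left factor, and it holds for every tensor `z`.
    have h : ∀ z : TensorAlgebra K V ⊗[K] TensorAlgebra K V,
        TensorProduct.map (contractTensor σ B) LinearMap.id (TensorProduct.map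
            (LinearMap.mulLeft K (TensorAlgebra.ι K a)) LinearMap.id z) +
          TensorProduct.map (tensorMap σ).toLinearMap (contractTensor σ B) (TensorProduct.map
            (LinearMap.mulLeft K (TensorAlgebra.ι K a)) LinearMap.id z) =
        TensorProduct.map (LinearMap.mulLeft K (TensorAlgebra.ι K (σ a))) LinearMap.id
            (TensorProduct.map (contractTensor σ B) LinearMap.id z) +
          TensorProduct.map (LinearMap.mulLeft K (TensorAlgebra.ι K (σ a))) LinearMap.id
            (TensorProduct.map (tensorMap σ).toLinearMap (contractTensor σ B) z) +
          TensorProduct.map (contractInitial B) LinearMap.id (TensorProduct.map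
            (LinearMap.mulLeft K (TensorAlgebra.ι K a)) LinearMap.id z) := by
      intro z
      induction z using TensorProduct.induction_on with
      | zero => simp
      | add x y hx hy =>
        simp only [map_add]
        rw [add_add_add_comm, hx, hy]
        abel
      | tmul x y =>
        simp only [TensorProduct.map_tmul, LinearMap.mulLeft_apply, LinearMap.id_apply,
          contractTensor_ι_mul, AlgHom.toLinearMap_apply, tensorMap_ι_mul,
          TensorProduct.add_tmul]
        abel
    refine sub_eq_zero.1 (Eq.trans ?_ (sub_eq_zero.2 (h z).symm))
    abel

/-- Contracting and then pointing equals pointing and then contracting. This is what makes the half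
that is re-pointed by a coproduct transform by `contractDiass`. -/
theorem pointings_contractTensor (x : TensorAlgebra K V) :
    pointings K V (contractTensor σ B x) = contractDiass σ B (pointings K V x) := by
  suffices h : pointings K V ∘ₗ contractTensor σ B = contractDiass σ B ∘ₗ pointings K V from
    LinearMap.congr_fun h x
  refine hom_ext_monomial fun w => ?_
  simp only [LinearMap.comp_apply]
  induction w with
  | nil => simp [monomial_nil]
  | cons a w ih =>
    rw [monomial_cons, contractTensor_ι_mul, map_add, pointings_contractInitial,
      pointings_ι_mul (σ a), ih, ← monomial_cons, pointings_monomial_eq_pointSum, pointSum_cons]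
    simp only [map_add, map_pointSum, contractDiass_word_nil, contractDiass_word_cons,
      pointSum_add, pointings_monomial_eq_pointSum]
    abel

theorem comul₁_tmul (x : TensorAlgebra K V) (v : V) (y : TensorAlgebra K V) :
    comul₁ K V (x ⊗ₜ (v ⊗ₜ y)) = TensorProduct.map (TensorProduct.mk K _ _ x ∘ₗ
      TensorProduct.mk K _ _ v) (pointings K V) (deconc K V y) := by
  simp only [comul₁, LinearMap.comp_apply, TensorProduct.map_tmul, LinearMap.id_apply]
  generalize deconc K V y = z
  induction z using TensorProduct.induction_on with
  | zero => simp
  | add x y hx hy => simp only [map_add, TensorProduct.tmul_add, hx, hy]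
  | tmul x y => simp

theorem comul₂_tmul (x : TensorAlgebra K V) (p : V ⊗[K] TensorAlgebra K V) :
    comul₂ K V (x ⊗ₜ p) = TensorProduct.map (pointings K V)
      ((TensorProduct.mk K _ _).flip p) (deconc K V x) := by
  simp only [comul₂, LinearMap.comp_apply, TensorProduct.map_tmul, LinearMap.id_apply]
  generalize deconc K V x = z
  induction z using TensorProduct.induction_on with
  | zero => simp
  | add x y hx hy => simp only [map_add, TensorProduct.add_tmul, hx, hy]
  | tmul x y => simp

/-- The cut is to the right of the distinguished letter. Blocks to the left of that letter stay in
the left factor; blocks that contain it are handled by coassociativity; blocks to its right are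
handled by `deconc_contractTensor` and `pointings_contractTensor`. -/
theorem comul₁_contractDiass :
    comul₁ K V ∘ₗ contractDiass σ B =
      (TensorProduct.map (diassMap σ) (contractDiass σ B) +
        TensorProduct.map (contractDiass σ B) LinearMap.id) ∘ₗ comul₁ K V := by
  refine hom_ext_word fun l v r => ?_
  have h : comul₁ K V (word K l v r) = splitSum (fun x y =>
      word K l v x ⊗ₜ[K] pointings K V (monomial K y)) r := by
    simp only [word, comul₁_tmul, deconc_monomial_eq_splitSum, map_splitSum,
      TensorProduct.map_tmul, LinearMap.comp_apply, TensorProduct.mk_apply]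
  simp only [LinearMap.comp_apply, LinearMap.add_apply, h]
  simp only [map_splitSum, TensorProduct.map_tmul, LinearMap.id_apply, contractDiass_word,
    map_add, comul₁_tmul, deconc_contractTensor, deconc_monomial_eq_splitSum, splitSum_add,
    contractPointed_word, tmul_splitSum, LinearMap.comp_apply, TensorProduct.mk_apply,
    AlgHom.toLinearMap_apply, pointings_contractTensor, TensorProduct.add_tmul, diassMap_word,
    splitSum_tmul, tensorMap_monomial]
  rw [splitSum_comm (w := r) (w' := l)]
  -- For a block that contains the distinguished letter, the right-hand part of the word is split in
  -- three: the end of the block, the rest of the left factor, and the right factor.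
  have hs : ∀ (u : TensorAlgebra K V) (y : List V),
      splitSum (fun r₁ r₂ => splitSum (fun x₁ x₂ => (u ⊗ₜ[K]
        (B (word K y v x₁) ⊗ₜ[K] monomial K x₂)) ⊗ₜ[K] pointings K V (monomial K r₂)) r₁) r =
      splitSum (fun r₁ r₂ => splitSum (fun x₁ x₂ => (u ⊗ₜ[K]
        (B (word K y v r₁) ⊗ₜ[K] monomial K x₁)) ⊗ₜ[K] pointings K V (monomial K x₂)) r₂) r :=
    fun u y => splitSum_splitSum _ r
  simp only [hs]
  simp only [word]
  abel

theorem comul₂_contractDiass :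
    comul₂ K V ∘ₗ contractDiass σ B =
      (TensorProduct.map (diassMap σ) (contractDiass σ B) +
        TensorProduct.map (contractDiass σ B) LinearMap.id) ∘ₗ comul₂ K V := by
  refine hom_ext_word fun l v r => ?_
  have h : comul₂ K V (word K l v r) = splitSum (fun x y =>
      pointings K V (monomial K x) ⊗ₜ[K] word K y v r) l := by
    simp only [word, comul₂_tmul, deconc_monomial_eq_splitSum, map_splitSum,
      TensorProduct.map_tmul, LinearMap.flip_apply, TensorProduct.mk_apply]
  simp only [LinearMap.comp_apply, LinearMap.add_apply, h]
  simp only [map_splitSum, TensorProduct.map_tmul, LinearMap.id_apply, contractDiass_word,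
    map_add, comul₂_tmul, deconc_contractTensor, deconc_monomial_eq_splitSum, splitSum_add,
    LinearMap.flip_apply, TensorProduct.mk_apply, ← tensorMap_monomial, deconc_tensorMap,
    AlgHom.toLinearMap_apply, pointings_contractTensor, TensorProduct.tmul_add,
    pointings_tensorMap, tmul_splitSum,
    ← splitSum_splitSum (fun x y₁ y₂ => diassMap σ (pointings K V (monomial K x)) ⊗ₜ[K]
      (tensorMap σ (monomial K y₁) ⊗ₜ[K] contractPointed B (word K y₂ v r)))]
  simp only [word]
  abel

theorem toLetters_tmul (x : TensorAlgebra K V) (v : V) (y : TensorAlgebra K V) :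
    toLetters K V (x ⊗ₜ (v ⊗ₜ y)) = TensorAlgebra.algebraMapInv x •
      TensorAlgebra.algebraMapInv y • v := by
  simp [toLetters, smul_smul, mul_comm]

theorem algebraMapInv_monomial_cons (a : V) (w : List V) :
    TensorAlgebra.algebraMapInv (monomial K (a :: w)) = 0 := by
  simp [monomial, TensorAlgebra.algebraMapInv]

theorem algebraMapInv_contractInitial (x : TensorAlgebra K V) :
    TensorAlgebra.algebraMapInv (contractInitial B x) = 0 := by
  simp only [contractInitial, LinearMap.comp_apply]
  generalize deconc K V x = z
  induction z using TensorProduct.induction_on with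
  | zero => simp
  | add x y hx hy => simp only [map_add, hx, hy, add_zero]
  | tmul x y => simp [TensorAlgebra.algebraMapInv]

theorem algebraMapInv_contractTensor (x : TensorAlgebra K V) :
    TensorAlgebra.algebraMapInv (contractTensor σ B x) = 0 := by
  simp only [contractTensor, LinearMap.comp_apply]
  generalize deconc K V x = z
  induction z using TensorProduct.induction_on with
  | zero => simp
  | add x y hx hy => simp only [map_add, hx, hy, add_zero]
  | tmul x y => simp [algebraMapInv_contractInitial]

/-- A single letter remains only when the whole word is contracted. A block that misses the
distinguished letter leaves that letter next to the new one. -/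
theorem toLetters_comp_contractDiass : toLetters K V ∘ₗ contractDiass σ B = B := by
  refine hom_ext_word fun l v r => ?_
  have h : ∀ (x : TensorAlgebra K V) (y : List V),
      toLetters K V (x ⊗ₜ contractPointed B (word K y v r)) =
        TensorAlgebra.algebraMapInv x • B (word K y v r) := by
    intro x y
    rw [contractPointed_word, tmul_splitSum, map_splitSum, splitSum_eq_of_right]
    · simp [toLetters_tmul, monomial_nil]
    · intro u a w
      rw [toLetters_tmul, algebraMapInv_monomial_cons, zero_smul, smul_zero]
  rw [LinearMap.comp_apply, contractDiass_word, map_add, map_add, toLetters_tmul, toLetters_tmul,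
    algebraMapInv_contractTensor, algebraMapInv_contractTensor, zero_smul, zero_smul, smul_zero,
    zero_add, add_zero, map_splitSum]
  simp only [h]
  rw [splitSum_eq_of_left]
  · simp [monomial_nil]
  · intro a x y
    rw [List.map_cons, algebraMapInv_monomial_cons, zero_smul]

/-! ### Uniqueness of a coderivation with given corestriction. -/

/-- `w ↦ w` on the words of positive length, `1 ↦ 0`. -/
def augmentation : TensorAlgebra K V →ₗ[K] TensorAlgebra K V :=
  LinearMap.id - Algebra.linearMap K _ ∘ₗ TensorAlgebra.algebraMapInv.toLinearMap

/-- `l ⊗ v ⊗ r ↦ v r` if `l` is empty, `0` otherwise. -/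
def mergeInitial : Diass K V →ₗ[K] TensorAlgebra K V :=
  (TensorProduct.lid K _).toLinearMap ∘ₗ
    TensorProduct.map TensorAlgebra.algebraMapInv.toLinearMap
      (LinearMap.mul' K _ ∘ₗ TensorProduct.map (TensorAlgebra.ι K) LinearMap.id)

theorem mergeInitial_word (l : List V) (v : V) (r : List V) :
    mergeInitial (word K l v r) = TensorAlgebra.algebraMapInv (monomial K l) •
      monomial K (v :: r) := by
  simp [mergeInitial, word, monomial_cons]

theorem mergeInitial_pointings (x : TensorAlgebra K V) :
    mergeInitial (pointings K V x) = augmentation x := by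
  suffices h : mergeInitial ∘ₗ pointings K V = augmentation from LinearMap.congr_fun h x
  refine hom_ext_monomial fun w => ?_
  rw [LinearMap.comp_apply, pointings_monomial_eq_pointSum, map_pointSum]
  cases w with
  | nil => simp [augmentation, monomial_nil]
  | cons a w =>
    have h₀ : ∀ w : List V, pointSum (fun _ _ _ => (0 : TensorAlgebra K V)) w = 0 := fun w => by
      induction w with
      | nil => rfl
      | cons a w ih => simp [ih]
    simp only [pointSum_cons, mergeInitial_word, algebraMapInv_monomial_cons, zero_smul, h₀]
    simp [augmentation, algebraMapInv_monomial_cons, monomial_nil]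

/-- `△₁ x` determines the part of `x` with a letter to the right of the distinguished one. -/
theorem augmentation_right_eq_zero {x : Diass K V} (hx : comul₁ K V x = 0) :
    TensorProduct.map LinearMap.id (TensorProduct.map LinearMap.id augmentation) x = 0 := by
  let Z : TensorAlgebra K V →ₗ[K] _ := TensorProduct.map LinearMap.id (pointings K V) ∘ₗ deconc K V
  let R : TensorAlgebra K V ⊗[K] Diass K V →ₗ[K] TensorAlgebra K V :=
    (TensorProduct.lid K _).toLinearMap ∘ₗ
      TensorProduct.map TensorAlgebra.algebraMapInv.toLinearMap mergeInitial
  -- The counit in `R` keeps only the cut with empty left half, and `mergeInitial` keeps only the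
  -- pointing at the first letter. So a nonempty word is recovered exactly once.
  have hR : R ∘ₗ Z = augmentation := by
    refine hom_ext_monomial fun w => ?_
    simp only [R, Z, LinearMap.comp_apply, deconc_monomial_eq_splitSum, map_splitSum,
      TensorProduct.map_tmul, LinearMap.id_apply, mergeInitial_pointings, LinearEquiv.coe_coe,
      TensorProduct.lid_tmul, AlgHom.toLinearMap_apply]
    rw [splitSum_eq_of_left]
    · simp [monomial_nil]
    · intro a x y
      rw [algebraMapInv_monomial_cons, zero_smul]
  have h₁ : TensorProduct.map LinearMap.id
      ((TensorProduct.assoc K V (TensorAlgebra K V) (Diass K V)).symm.toLinearMap ∘ₗ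
        TensorProduct.map LinearMap.id Z) x = 0 :=
    (LinearEquiv.map_eq_zero_iff (TensorProduct.assoc K (TensorAlgebra K V)
      (V ⊗[K] TensorAlgebra K V) (Diass K V)).symm).1 hx
  have h₂ := congrArg (TensorProduct.map (LinearMap.id (R := K) (M := TensorAlgebra K V))
    (TensorProduct.map LinearMap.id R ∘ₗ
      (TensorProduct.assoc K V (TensorAlgebra K V) (Diass K V)).toLinearMap)) h₁
  rw [map_zero, ← LinearMap.comp_apply, ← TensorProduct.map_comp] at h₂
  rw [← h₂, ← hR]
  congr 2
  ext; simp

/-- `△₂ x` determines the part of `x` with a letter to the left of the distinguished one. -/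
theorem augmentation_left_eq_zero {x : Diass K V} (hx : comul₂ K V x = 0) :
    TensorProduct.map augmentation LinearMap.id x = 0 := by
  let Z : TensorAlgebra K V →ₗ[K] _ := TensorProduct.map (pointings K V) LinearMap.id ∘ₗ deconc K V
  let R : Diass K V ⊗[K] TensorAlgebra K V →ₗ[K] TensorAlgebra K V :=
    (TensorProduct.rid K _).toLinearMap ∘ₗ
      TensorProduct.map mergeInitial TensorAlgebra.algebraMapInv.toLinearMap
  have hR : R ∘ₗ Z = augmentation := by
    refine hom_ext_monomial fun w => ?_
    simp only [R, Z, LinearMap.comp_apply, deconc_monomial_eq_splitSum, map_splitSum,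
      TensorProduct.map_tmul, LinearMap.id_apply, mergeInitial_pointings, LinearEquiv.coe_coe,
      TensorProduct.rid_tmul, AlgHom.toLinearMap_apply]
    rw [splitSum_eq_of_right]
    · simp [monomial_nil]
    · intro a x y
      rw [algebraMapInv_monomial_cons, zero_smul]
  have h₁ : TensorProduct.map Z LinearMap.id x = 0 :=
    (LinearEquiv.map_eq_zero_iff (TensorProduct.assoc K (Diass K V) (TensorAlgebra K V)
      (V ⊗[K] TensorAlgebra K V))).1 hx
  have h₂ := congrArg (TensorProduct.map R LinearMap.id) h₁
  rw [map_zero, ← LinearMap.comp_apply, ← TensorProduct.map_comp, hR, LinearMap.id_comp] at h₂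
  exact h₂

theorem eq_zero_of_comul_eq_zero {x : Diass K V} (h₁ : comul₁ K V x = 0)
    (h₂ : comul₂ K V x = 0) (h : toLetters K V x = 0) : x = 0 := by
  let ε : TensorAlgebra K V →ₗ[K] K := TensorAlgebra.algebraMapInv.toLinearMap
  let J : V →ₗ[K] Diass K V := TensorProduct.mk K _ _ 1 ∘ₗ (TensorProduct.mk K V _).flip 1
  -- The identity splits into the projections onto words with a letter on the right, words with
  -- letters on the left only, and single letters. The hypotheses kill these in turn.
  have key : LinearMap.id = TensorProduct.map LinearMap.id (TensorProduct.map LinearMap.id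
        augmentation) +
      TensorProduct.map LinearMap.id (TensorProduct.map LinearMap.id
        (Algebra.linearMap K _ ∘ₗ ε)) ∘ₗ TensorProduct.map augmentation LinearMap.id +
      J ∘ₗ toLetters K V := by
    refine hom_ext_word fun l v r => ?_
    simp only [word, LinearMap.add_apply, LinearMap.comp_apply, TensorProduct.map_tmul,
      LinearMap.id_apply, augmentation, LinearMap.sub_apply, toLetters_tmul, J, ε,
      Algebra.linearMap_apply, Algebra.algebraMap_eq_smul_one, map_smul,
      AlgHom.toLinearMap_apply, TensorProduct.mk_apply, LinearMap.flip_apply,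
      TensorProduct.tmul_sub, TensorProduct.sub_tmul, TensorProduct.tmul_smul, map_sub,
      ← TensorProduct.smul_tmul']
    rw [smul_comm]
    abel
  have := LinearMap.congr_fun key x
  simpa only [LinearMap.add_apply, LinearMap.comp_apply, augmentation_right_eq_zero h₁,
    augmentation_left_eq_zero h₂, h, map_zero, add_zero, LinearMap.id_apply] using this

/-- A coderivation of `Diass^c(V)` is determined by its corestriction to `V`. -/
theorem eq_zero_of_toLetters_comp_eq_zero {D S T : Diass K V →ₗ[K] Diass K V}
    (h₁ : comul₁ K V ∘ₗ D = (TensorProduct.map S D + TensorProduct.map D T) ∘ₗ comul₁ K V)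
    (h₂ : comul₂ K V ∘ₗ D = (TensorProduct.map S D + TensorProduct.map D T) ∘ₗ comul₂ K V)
    (h : toLetters K V ∘ₗ D = 0) : D = 0 := by
  -- Both tensor factors in either coproduct of a word are strictly shorter than the word, so `D`
  -- vanishes on them by induction, whatever `S` and `T` are.
  have key : ∀ (n : ℕ) (l : List V) (v : V) (r : List V), l.length + r.length = n →
      D (word K l v r) = 0 := by
    intro n
    induction n using Nat.strong_induction_on with
    | _ n ih =>
      intro l v r hn
      refine eq_zero_of_comul_eq_zero ?_ ?_ (LinearMap.congr_fun h _)
      · rw [← LinearMap.comp_apply, h₁, LinearMap.comp_apply, comul₁_word, map_sum]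
        refine Finset.sum_eq_zero fun i _ => ?_
        rw [map_sum]
        refine Finset.sum_eq_zero fun j _ => ?_
        have hj := j.2
        simp only [List.length_drop] at hj
        rw [LinearMap.add_apply, TensorProduct.map_tmul, TensorProduct.map_tmul,
          ih _ _ _ _ _ rfl, ih _ _ _ _ _ rfl, TensorProduct.tmul_zero, TensorProduct.zero_tmul,
          add_zero] <;> simp only [List.length_take, List.length_drop] <;> omega
      · rw [← LinearMap.comp_apply, h₂, LinearMap.comp_apply, comul₂_word, map_sum]
        refine Finset.sum_eq_zero fun i _ => ?_
        rw [map_sum]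
        refine Finset.sum_eq_zero fun j _ => ?_
        have hj := j.2
        simp only [List.length_take] at hj
        rw [LinearMap.add_apply, TensorProduct.map_tmul, TensorProduct.map_tmul,
          ih _ _ _ _ _ rfl, ih _ _ _ _ _ rfl, TensorProduct.tmul_zero, TensorProduct.zero_tmul,
          add_zero] <;> simp only [List.length_take, List.length_drop] <;> omega
  exact hom_ext_word fun l v r => key _ l v r rfl

end Cofree

/-! ### Pointed words as multilinear maps, and linear maps defined from them. -/

section PointedWords

variable {K V W : Type*} [Field K] [AddCommGroup V] [Module K V] [AddCommMonoid W] [Module K W]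

theorem word_eq_pointedWord {n : ℕ} (a : Fin n → V) (i : Fin n) {l : List V} {v : V} {r : List V}
    (hl : l.length = i) (hr : i + 1 + r.length = n)
    (h₁ : ∀ (t : ℕ) (ht : t < l.length), l[t] = a ⟨t, by omega⟩) (h₂ : v = a i)
    (h₃ : ∀ (t : ℕ) (ht : t < r.length), r[t] = a ⟨i + 1 + t, by omega⟩) :
    word K l v r = pointedWord K a i := by
  have hl' : l = (List.ofFn a).take i := by
    refine List.ext_getElem (by simp; omega) fun t ht _ => ?_
    simp [h₁ t ht]
  have hr' : r = (List.ofFn a).drop (i + 1) := by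
    refine List.ext_getElem (by simp; omega) fun t ht _ => ?_
    simp [h₃ t ht]
  rw [pointedWord, ← hl', ← hr', h₂]

theorem word_eq_pointedWord_get (l : List V) (v : V) (r : List V) :
    word K l v r = pointedWord K (fun t : Fin (l ++ v :: r).length => (l ++ v :: r)[t])
      ⟨l.length, by simp⟩ := by
  refine word_eq_pointedWord _ _ rfl (by simp; omega) ?_ ?_ ?_
  · intro t ht
    simp [List.getElem_append_left ht]
  · simp
  · intro t ht
    simp [List.getElem_append_right, Nat.add_assoc, Nat.add_comm 1 t]

theorem hom_ext_pointedWord {f g : Diass K V →ₗ[K] W}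
    (h : ∀ (n : ℕ) (a : Fin n → V) (i : Fin n), f (pointedWord K a i) = g (pointedWord K a i)) :
    f = g :=
  hom_ext_word fun l v r => by rw [word_eq_pointedWord_get]; exact h _ _ _

theorem ofFn_update {α : Type*} {n : ℕ} [DecidableEq (Fin n)] (a : Fin n → α) (i : Fin n) (x : α) :
    List.ofFn (Function.update a i x) = (List.ofFn a).set i x := by
  refine List.ext_getElem (by simp) fun t ht _ => ?_
  simp [List.getElem_set, Function.update_apply, Fin.ext_iff, eq_comm]

theorem monomial_set_add (l : List V) (i : ℕ) (h : i < l.length) (x y : V) :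
    monomial K (l.set i (x + y)) = monomial K (l.set i x) + monomial K (l.set i y) := by
  simp only [List.set_eq_take_append_cons_drop, if_pos h, monomial_append, monomial_cons, map_add,
    add_mul, mul_add]

theorem monomial_set_smul (l : List V) (i : ℕ) (h : i < l.length) (c : K) (x : V) :
    monomial K (l.set i (c • x)) = c • monomial K (l.set i x) := by
  simp only [List.set_eq_take_append_cons_drop, if_pos h, monomial_append, monomial_cons, map_smul,
    smul_mul_assoc, mul_smul_comm]

/-- The pointed words `a_1 ⋯ a_{i-1} ⊗ a_i ⊗ a_{i+1} ⋯ a_n` as a multilinear map. -/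
def pointedWordMultilinear (K : Type*) {V : Type*} [Field K] [AddCommGroup V] [Module K V] {n : ℕ}
    (i : Fin n) : MultilinearMap K (fun _ : Fin n => V) (Diass K V) where
  toFun a := pointedWord K a i
  map_update_add' a t x y := by
    simp only [pointedWord, word, ofFn_update, List.take_set, List.drop_set]
    rcases lt_trichotomy t i with h | rfl | h
    · have h' : (t : ℕ) < i := h
      rw [if_pos (by omega), monomial_set_add _ _ (by simp; omega),
        Function.update_of_ne h.ne', Function.update_of_ne h.ne', Function.update_of_ne h.ne']
      simp [TensorProduct.add_tmul, Nat.lt_succ_of_lt h']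
    · simp [TensorProduct.tmul_add, TensorProduct.add_tmul, List.set_eq_of_length_le]
    · have h' : (i : ℕ) < t := h
      rw [if_neg (by omega), monomial_set_add (List.drop _ _) _ (by simp; omega),
        Function.update_of_ne h.ne, Function.update_of_ne h.ne, Function.update_of_ne h.ne]
      have hset : ∀ z, ((List.ofFn a).take i).set t z = (List.ofFn a).take i :=
        fun z => List.set_eq_of_length_le (by simp; omega)
      simp [hset, TensorProduct.tmul_add, (show ¬ (t : ℕ) < i + 1 by omega)]
  map_update_smul' a t c x := by
    simp only [pointedWord, word, ofFn_update, List.take_set, List.drop_set]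
    rcases lt_trichotomy t i with h | rfl | h
    · have h' : (t : ℕ) < i := h
      rw [if_pos (by omega), monomial_set_smul _ _ (by simp; omega),
        Function.update_of_ne h.ne', Function.update_of_ne h.ne']
      simp [TensorProduct.smul_tmul', Nat.lt_succ_of_lt h']
    · simp [TensorProduct.tmul_smul, ← TensorProduct.smul_tmul', List.set_eq_of_length_le]
    · have h' : (i : ℕ) < t := h
      rw [if_neg (by omega), monomial_set_smul (List.drop _ _) _ (by simp; omega),
        Function.update_of_ne h.ne, Function.update_of_ne h.ne]
      have hset : ∀ z, ((List.ofFn a).take i).set t z = (List.ofFn a).take i :=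
        fun z => List.set_eq_of_length_le (by simp; omega)
      simp [hset, TensorProduct.tmul_smul, (show ¬ (t : ℕ) < i + 1 by omega)]

@[simp] theorem pointedWordMultilinear_apply {n : ℕ} (i : Fin n) (a : Fin n → V) :
    pointedWordMultilinear K i a = pointedWord K a i := rfl

/-- Multilinear maps that agree on homogeneous elements are equal. -/
theorem multilinear_ext_homogeneous (𝒱 : ℤ → Submodule K V) [DirectSum.Decomposition 𝒱] {n : ℕ}
    {f g : MultilinearMap K (fun _ : Fin n => V) W}
    (h : ∀ (a : Fin n → V) (d : Fin n → ℤ), (∀ t, a t ∈ 𝒱 (d t)) → f a = g a) : f = g := by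
  classical
  ext a
  have ha : a = fun t => ∑ i ∈ (DirectSum.decompose 𝒱 (a t)).support,
      (DirectSum.decompose 𝒱 (a t) i : V) :=
    funext fun t => (DirectSum.sum_support_decompose 𝒱 (a t)).symm
  rw [ha, f.map_sum_finset, g.map_sum_finset]
  exact Finset.sum_congr rfl fun d _ => h _ d fun t => SetLike.coe_mem _

theorem hom_ext_homogeneous (𝒱 : ℤ → Submodule K V) [DirectSum.Decomposition 𝒱]
    {f g : Diass K V →ₗ[K] W}
    (h : ∀ (n : ℕ) (a : Fin n → V) (d : Fin n → ℤ) (i : Fin n), (∀ t, a t ∈ 𝒱 (d t)) →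
      f (pointedWord K a i) = g (pointedWord K a i)) : f = g := by
  refine hom_ext_pointedWord fun n a i => ?_
  have := multilinear_ext_homogeneous 𝒱 (f := f.compMultilinearMap (pointedWordMultilinear K i))
    (g := g.compMultilinearMap (pointedWordMultilinear K i)) fun a d ha => h n a d i ha
  exact congrArg (fun φ => φ a) this

/-- The map `TV ⊗ V ⊗ TV → T(V × V)` that marks the distinguished letter. -/
def markLetter : Diass K V →ₗ[K] TensorAlgebra K (V × V) :=
  let T := (TensorAlgebra.lift K (TensorAlgebra.ι K ∘ₗ LinearMap.inl K V V)).toLinearMap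
  LinearMap.mul' K _ ∘ₗ TensorProduct.map T
    (LinearMap.mul' K _ ∘ₗ TensorProduct.map (TensorAlgebra.ι K ∘ₗ LinearMap.inr K V V) T)

theorem markLetter_pointedWord {n : ℕ} (a : Fin n → V) (i : Fin n) :
    markLetter (pointedWord K a i) =
      TensorAlgebra.tprod K (V × V) n fun t => if t = i then (0, a t) else (a t, 0) := by
  have hT : ∀ w : List V, TensorAlgebra.lift K (TensorAlgebra.ι K ∘ₗ LinearMap.inl K V V)
      (monomial K w) = ((w.map fun x => ((x, 0) : V × V)).map (TensorAlgebra.ι K)).prod := by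
    intro w
    simp [monomial, map_list_prod, Function.comp_def]
  rw [TensorAlgebra.tprod_apply]
  simp only [markLetter, pointedWord, word, LinearMap.comp_apply, TensorProduct.map_tmul,
    AlgHom.toLinearMap_apply, hT, LinearMap.mul'_apply, LinearMap.inr_apply]
  rw [← List.prod_cons, ← List.prod_append, ← List.map_cons (f := TensorAlgebra.ι K),
    ← List.map_append]
  congr 1
  refine List.ext_getElem (by simp; omega) fun t ht ht' => ?_
  simp only [List.length_ofFn] at ht'
  simp only [List.getElem_map, List.getElem_append, List.getElem_cons, List.getElem_ofFn,
    List.getElem_take, List.getElem_drop, List.length_map, List.length_take, List.length_ofFn,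
    Fin.ext_iff]
  split_ifs <;> first | omega | skip
  · rfl
  · obtain rfl : i = ⟨t, ht'⟩ := Fin.ext (by assumption : t = i).symm
    rfl
  · have : (i : ℕ) + 1 + (t - min (i : ℕ) n - 1) = t := by omega
    simp only [this]

/-- The linear map on `TV ⊗ V ⊗ TV` with prescribed multilinear restrictions to the words with
given length and position of the distinguished letter. -/
def ofMultilinear (f : ∀ n : ℕ, Fin n → MultilinearMap K (fun _ : Fin n => V) W) :
    Diass K V →ₗ[K] W :=
  DirectSum.toModule K ℕ W (fun n => PiTensorProduct.lift (∑ i : Fin n,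
      (f n i).compLinearMap fun t => if t = i then LinearMap.snd K V V else LinearMap.fst K V V)) ∘ₗ
    TensorAlgebra.toDirectSum.toLinearMap ∘ₗ markLetter

theorem ofMultilinear_pointedWord
    (f : ∀ n : ℕ, Fin n → MultilinearMap K (fun _ : Fin n => V) W) {n : ℕ} (a : Fin n → V)
    (i : Fin n) : ofMultilinear f (pointedWord K a i) = f n i a := by
  simp only [ofMultilinear, LinearMap.comp_apply, markLetter_pointedWord,
    AlgHom.toLinearMap_apply, TensorAlgebra.toDirectSum_tensorPower_tprod]
  refine (DirectSum.toModule_lof (R := K) (ι := ℕ) (M := fun n => ⨂[K]^n (V × V)) n _).trans ?_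
  rw [PiTensorProduct.lift.tprod, sum_apply, Finset.sum_eq_single i]
  · rw [MultilinearMap.compLinearMap_apply]
    congr 1
    ext t
    by_cases h : t = i <;> simp [h]
  -- Slot `j` carries an unmarked letter `(a j, 0)`, which the second projection sends to zero.
  · intro j _ hj
    rw [MultilinearMap.compLinearMap_apply]
    exact (f n j).map_coord_zero j (by simp [hj])
  · simp

end PointedWords

/-! ### The coderivation as a sum over blocks, and the symbols `R_0`, `R_i`. -/

section Blocks

variable {K V : Type*} [Field K] [AddCommGroup V] [Module K V]
  (σ : V →ₗ[K] V) (B : Diass K V →ₗ[K] V)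

/-- The contraction of the letters `s, …, s + p` of the word `l ⊗ v ⊗ r`. -/
def contractBlock (l : List V) (v : V) (r : List V) (s p : ℕ) : Diass K V :=
  if s + p + 1 ≤ l.length then
    word K ((l.take s).map σ ++ totalContraction B (monomial K ((l.drop s).take (p + 1))) ::
      (l.drop s).drop (p + 1)) v r
  else if s ≤ l.length then
    word K ((l.take s).map σ) (B (word K (l.drop s) v (r.take (s + p - l.length))))
      (r.drop (s + p - l.length))
  else
    word K (l.map σ) (σ v) ((r.take (s - l.length - 1)).map σ ++
      totalContraction B (monomial K ((r.drop (s - l.length - 1)).take (p + 1))) ::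
        (r.drop (s - l.length - 1)).drop (p + 1))

theorem contractTensor_monomial_eq_sum (w : List V) :
    contractTensor σ B (monomial K w) = ∑ s ∈ Finset.range w.length,
      ∑ p ∈ Finset.range (w.length - s), monomial K ((w.take s).map σ ++
        totalContraction B (monomial K ((w.drop s).take (p + 1))) ::
          (w.drop s).drop (p + 1)) := by
  have hE : ∀ y : List V, contractInitial B (monomial K y) = ∑ p ∈ Finset.range y.length,
      monomial K (totalContraction B (monomial K (y.take (p + 1))) :: y.drop (p + 1)) := by
    intro y
    rw [contractInitial_monomial, splitSum_eq_sum_range, Finset.sum_range_succ']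
    simp [monomial_cons, monomial_nil]
  rw [contractTensor_monomial, splitSum_eq_sum_range, Finset.sum_range_succ]
  simp [hE, Finset.mul_sum, monomial_append]

theorem contractDiass_word_eq_sum (l : List V) (v : V) (r : List V) :
    contractDiass σ B (word K l v r) = ∑ p ∈ Finset.range (l.length + 1 + r.length),
      ∑ s ∈ Finset.range (l.length + 1 + r.length - p), contractBlock σ B l v r s p := by
  -- With the start `s` fixed first, the three families of terms separate: for `s ≤ l.length` a
  -- block ends before the distinguished letter or contains it, and for larger `s` it lies to the
  -- right.
  rw [Finset.sum_comm' (t' := Finset.range (l.length + 1 + r.length))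
    (s' := fun s => Finset.range (l.length + 1 + r.length - s))
    (by intro p s; simp only [Finset.mem_range]; omega), Finset.sum_range_add]
  have h₁ : ∀ s ∈ Finset.range (l.length + 1),
      ∑ p ∈ Finset.range (l.length + 1 + r.length - s), contractBlock σ B l v r s p =
      (∑ p ∈ Finset.range (l.length - s), word K ((l.take s).map σ ++
        totalContraction B (monomial K ((l.drop s).take (p + 1))) ::
          (l.drop s).drop (p + 1)) v r) +
      ∑ j ∈ Finset.range (r.length + 1), word K ((l.take s).map σ)
        (B (word K (l.drop s) v (r.take j))) (r.drop j) := by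
    intro s hs
    have hs' : s ≤ l.length := Nat.lt_succ_iff.1 (Finset.mem_range.1 hs)
    rw [show l.length + 1 + r.length - s = (l.length - s) + (r.length + 1) by omega,
      Finset.sum_range_add]
    congr 1
    · refine Finset.sum_congr rfl fun p hp => ?_
      have := Finset.mem_range.1 hp
      rw [contractBlock, if_pos (by omega)]
    · refine Finset.sum_congr rfl fun j _ => ?_
      rw [contractBlock, if_neg (by omega), if_pos hs',
        show s + (l.length - s + j) - l.length = j by omega]
  have h₂ : ∀ s ∈ Finset.range r.length,
      ∑ p ∈ Finset.range (l.length + 1 + r.length - (l.length + 1 + s)),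
        contractBlock σ B l v r (l.length + 1 + s) p =
      ∑ p ∈ Finset.range (r.length - s), word K (l.map σ) (σ v) ((r.take s).map σ ++
        totalContraction B (monomial K ((r.drop s).take (p + 1))) ::
          (r.drop s).drop (p + 1)) := by
    intro s _
    rw [show l.length + 1 + r.length - (l.length + 1 + s) = r.length - s by omega]
    refine Finset.sum_congr rfl fun p _ => ?_
    rw [contractBlock, if_neg (by omega), if_neg (by omega),
      show l.length + 1 + s - l.length - 1 = s by omega]
  rw [Finset.sum_congr rfl h₁, Finset.sum_congr rfl h₂, Finset.sum_add_distrib,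
    Finset.sum_range_succ _ l.length, contractDiass_word, contractTensor_monomial_eq_sum,
    contractTensor_monomial_eq_sum, splitSum_eq_sum_range]
  simp only [contractPointed_word, splitSum_eq_sum_range]
  simp only [word, TensorProduct.tmul_sum,
    TensorProduct.sum_tmul, Nat.sub_self, Finset.range_zero, Finset.sum_empty, add_zero]

theorem pointings_ofFn {n : ℕ} (a : Fin n → V) :
    pointings K V (monomial K (List.ofFn a)) = ∑ i : Fin n, pointedWord K a i := by
  rw [pointings_monomial]
  refine Fintype.sum_equiv (finCongr (by simp)) _ _ fun i => ?_
  have hi : (i : ℕ) < n := by simpa using i.2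
  refine word_eq_pointedWord _ _ ?_ ?_ ?_ ?_ ?_
  · simp; omega
  · simp; omega
  · intro t ht
    simp
  · simp; rfl
  · intro t ht
    simp

/-- The value of `B` on the block `a_i, …, a_{i+n-1}` of a word of length `N`. -/
def blockValue {N m : ℕ} (n : ℕ) (h : N + 1 = m + n) (i : Fin m) (r : Fin N) (a : Fin N → V) : V :=
  Finsupp.linearCombination K
    (fun u : Fin n => B (pointedWord K (fun u : Fin n => a ⟨i + u, by omega⟩) u))
    (innerSymbol K n i r)

/-- The word obtained from `a_1 ⋯ a_N` by applying `φ` to the letters in front of the block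
`a_i, …, a_{i+n-1}` and replacing this block by `x`. -/
def replaceBlock {α : Type*} {N m n : ℕ} (h : N + 1 = m + n) (i : Fin m) (φ : α → α) (x : α)
    (a : Fin N → α) : Fin m → α := fun t =>
  if h₁ : t < i then φ (a ⟨t, by have := t.2; have := i.2; omega⟩)
  else if h₂ : t = i then x
  else a ⟨t + n - 1, by have := t.2; have := i.2; omega⟩

/-- The position of the block relative to the distinguished letter (before, around, after) gives the
three cases of `outerSymbol`, and `innerSymbol` tells only whether the letter is in the block. -/
theorem contractBlock_eq_pointedWord {N m p : ℕ} (h : N + 1 = m + (p + 1)) (i : Fin m)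
    (r : Fin N) (a : Fin N → V) :
    contractBlock σ B ((List.ofFn a).take r) (a r) ((List.ofFn a).drop (r + 1)) i p =
      pointedWord K (replaceBlock h i σ (blockValue B (p + 1) h i r a) a)
        (outerSymbol h i r) := by
  have hr := r.2
  have hi := i.2
  have hlen : ((List.ofFn a).take r).length = r := by simp
  rw [contractBlock, hlen]
  -- For a block without the distinguished letter, `innerSymbol` is the sum of all symbols, which
  -- matches the sum over all pointings in `totalContraction`.
  have hout : ¬((i : ℕ) ≤ r ∧ (r : ℕ) < i + (p + 1)) → ∀ w : List V,
      w = List.ofFn (fun u : Fin (p + 1) => a ⟨i + u, by omega⟩) →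
      totalContraction B (monomial K w) = blockValue B (p + 1) h i r a := by
    rintro hn _ rfl
    rw [blockValue, innerSymbol, dif_neg hn, map_sum, totalContraction, LinearMap.comp_apply,
      pointings_ofFn, map_sum]
    simp
  split_ifs with h₁ h₂
  · have hv := hout (by omega) ((((List.ofFn a).take r).drop i).take (p + 1))
      (List.ext_getElem (by simp; omega) fun t ht _ => by
        simp only [List.getElem_take, List.getElem_drop, List.getElem_ofFn])
    have ho : (outerSymbol h i r : ℕ) = r - p := by
      simp only [outerSymbol]; split_ifs <;> omega
    rw [hv]
    refine word_eq_pointedWord _ _ ?_ ?_ ?_ ?_ ?_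
    · simp; omega
    · simp; omega
    · intro t ht
      simp only [List.length_append, List.length_cons, List.length_map, List.length_take,
        List.length_drop, List.length_ofFn] at ht
      simp only [List.getElem_append, List.getElem_cons, List.getElem_map, List.getElem_take,
        List.getElem_drop, List.getElem_ofFn, List.length_map, List.length_take,
        List.length_ofFn, replaceBlock, Fin.lt_def, Fin.ext_iff]
      split_ifs <;> first | omega | rfl | exact congrArg a (Fin.ext (by simp only []; omega))
    · simp only [replaceBlock, Fin.lt_def, Fin.ext_iff, ho]
      split_ifs <;> first | omega | exact congrArg a (Fin.ext (by simp only []; omega))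
    · intro t ht
      simp only [List.length_drop, List.length_ofFn] at ht
      simp only [List.getElem_drop, List.getElem_ofFn, replaceBlock, Fin.lt_def, Fin.ext_iff, ho]
      split_ifs <;> first | omega | exact congrArg a (Fin.ext (by simp only []; omega))
  · have hv : blockValue B (p + 1) h i r a = B (word K (((List.ofFn a).take r).drop i) (a r)
        (((List.ofFn a).drop (r + 1)).take (i + p - r))) := by
      rw [blockValue, innerSymbol, dif_pos (by omega), Finsupp.linearCombination_single, one_smul]
      congr 1
      refine (word_eq_pointedWord _ _ ?_ ?_ ?_ ?_ ?_).symm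
      · simp
      · simp; omega
      · intro t ht
        simp only [List.getElem_take, List.getElem_drop, List.getElem_ofFn]
      · exact congrArg a (Fin.ext (by simp only []; omega))
      · intro t ht
        simp only [List.getElem_take, List.getElem_drop, List.getElem_ofFn]
        exact congrArg a (Fin.ext (by simp only []; omega))
    have ho : (outerSymbol h i r : ℕ) = i := by
      simp only [outerSymbol]; split_ifs <;> omega
    rw [← hv]
    refine word_eq_pointedWord _ _ ?_ ?_ ?_ ?_ ?_
    · simp; omega
    · simp; omega
    · intro t ht
      simp only [List.length_map, List.length_take, List.length_ofFn] at ht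
      simp only [List.getElem_map, List.getElem_take, List.getElem_ofFn, replaceBlock, Fin.lt_def]
      rw [dif_pos (by omega)]
    · simp only [replaceBlock, Fin.lt_def, Fin.ext_iff, ho]
      rw [dif_neg (by omega), dif_pos trivial]
    · intro t ht
      simp only [List.length_drop, List.length_ofFn] at ht
      simp only [List.getElem_drop, List.getElem_ofFn, replaceBlock, Fin.lt_def, Fin.ext_iff, ho]
      split_ifs <;> first | omega | exact congrArg a (Fin.ext (by simp only []; omega))
  · have hv := hout (by omega) ((((List.ofFn a).drop (r + 1)).drop (i - r - 1)).take (p + 1))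
      (List.ext_getElem (by simp; omega) fun t ht _ => by
        simp only [List.getElem_take, List.getElem_drop, List.getElem_ofFn]
        exact congrArg a (Fin.ext (by simp only []; omega)))
    have ho : (outerSymbol h i r : ℕ) = r := by
      simp only [outerSymbol]; split_ifs <;> omega
    rw [hv]
    refine word_eq_pointedWord _ _ ?_ ?_ ?_ ?_ ?_
    · simp; omega
    · simp; omega
    · intro t ht
      simp only [List.length_map, List.length_take, List.length_ofFn] at ht
      simp only [List.getElem_map, List.getElem_take, List.getElem_ofFn, replaceBlock, Fin.lt_def]
      rw [dif_pos (by omega)]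
    · simp only [replaceBlock, Fin.lt_def, ho]
      rw [dif_pos (by omega)]
    · intro t ht
      simp only [List.length_append, List.length_cons, List.length_map, List.length_take,
        List.length_drop, List.length_ofFn] at ht
      simp only [List.getElem_append, List.getElem_cons, List.getElem_map, List.getElem_take,
        List.getElem_drop, List.getElem_ofFn, List.length_map, List.length_take,
        List.length_drop, List.length_ofFn, replaceBlock, Fin.lt_def, Fin.ext_iff, ho]
      split_ifs <;> first | omega | rfl | exact congrArg a (Fin.ext (by simp only []; omega))

theorem succ_eq_sub_add_succ {N : ℕ} (p : Fin N) : N + 1 = N - p + (p + 1) := by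
  have := p.2
  omega

theorem contractDiass_pointedWord {N : ℕ} (a : Fin N → V) (r : Fin N) :
    contractDiass σ B (pointedWord K a r) = ∑ p : Fin N, ∑ l : Fin (N - p),
      pointedWord K (replaceBlock (succ_eq_sub_add_succ p) l σ
        (blockValue B (p + 1) (succ_eq_sub_add_succ p) l r a) a)
        (outerSymbol (succ_eq_sub_add_succ p) l r) := by
  have hN : ((List.ofFn a).take r).length + 1 + ((List.ofFn a).drop (r + 1)).length = N := by
    have := r.2
    simp
  rw [show pointedWord K a r = word K _ _ _ from rfl, contractDiass_word_eq_sum, hN,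
    Finset.sum_range]
  refine Finset.sum_congr rfl fun p _ => ?_
  rw [Finset.sum_range]
  exact Finset.sum_congr rfl fun l _ => contractBlock_eq_pointedWord σ B _ l r a

end Blocks

/-! ### Sign maps and the comparison of exponents. -/

section Signs

variable {K V : Type*} [Field K] [AddCommGroup V] [Module K V]

theorem neg_one_zpow_add (m n : ℤ) : (-1 : K) ^ (m + n) = (-1) ^ m * (-1) ^ n :=
  zpow_add₀ (neg_ne_zero.2 one_ne_zero) m n

theorem neg_one_zpow_two_mul (n : ℤ) : (-1 : K) ^ (2 * n) = 1 := by
  rw [zpow_mul]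
  norm_num

theorem neg_one_zpow_sum {ι : Type*} (s : Finset ι) (f : ι → ℤ) :
    ∏ i ∈ s, (-1 : K) ^ f i = (-1) ^ ∑ i ∈ s, f i := by
  classical
  induction s using Finset.induction_on with
  | empty => simp
  | insert i s hi ih => rw [Finset.prod_insert hi, Finset.sum_insert hi, ih, neg_one_zpow_add]

theorem signMap_signMap (𝒱 : ℤ → Submodule K V) [DirectSum.Decomposition 𝒱] (e : ℤ) (v : V) :
    signMap 𝒱 e (signMap 𝒱 e v) = v := by
  induction v using DirectSum.Decomposition.inductionOn 𝒱 with
  | zero => simp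
  | homogeneous v =>
    rw [signMap_apply 𝒱 e v.2, map_smul, signMap_apply 𝒱 e v.2, smul_smul, ← neg_one_zpow_add,
      ← two_mul, neg_one_zpow_two_mul, one_smul]
  | add v w hv hw => rw [map_add, map_add, hv, hw]

theorem signMap_mem (𝒱 : ℤ → Submodule K V) [DirectSum.Decomposition 𝒱] (e : ℤ) {i : ℤ} {v : V}
    (hv : v ∈ 𝒱 i) : signMap 𝒱 e v ∈ 𝒱 i := by
  rw [signMap_apply 𝒱 e hv]
  exact Submodule.smul_mem _ _ hv

/-- The splitting of a sum over `N` letters at a block of `n` letters. -/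
theorem sum_eq_sum_block {N m n : ℕ} (h : N + 1 = m + n) (i : Fin m) (f : ℕ → ℤ) :
    ∑ t : Fin N, f t = ∑ t ∈ Finset.range i, f t + ∑ u : Fin n, f (i + u) +
      ∑ t ∈ Finset.range (m - 1 - i), f (i + n + t) := by
  have := i.2
  rw [← Finset.sum_range, ← Finset.sum_range (fun u => f (i + u)),
    show N = i + n + (m - 1 - i) by omega, Finset.sum_range_add, Finset.sum_range_add]

theorem sum_ite_eq_sum_block {m : ℕ} (i : Fin m) (f g : ℕ → ℤ) (x : ℤ) :
    ∑ t : Fin m, (if (t : ℕ) < i then f t else if (t : ℕ) = i then x else g t) =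
      ∑ t ∈ Finset.range i, f t + x + ∑ t ∈ Finset.range (m - 1 - i), g (i + 1 + t) := by
  rw [← Finset.sum_range (fun t => if t < (i : ℕ) then f t else if t = (i : ℕ) then x else g t)]
  obtain ⟨i, hi⟩ := i
  obtain ⟨k, rfl⟩ : ∃ k, m = i + 1 + k := ⟨m - 1 - i, by omega⟩
  rw [Finset.sum_range_add, Finset.sum_range_succ, show i + 1 + k - 1 - i = k by omega]
  congr 1
  · congr 1
    · exact Finset.sum_congr rfl fun t ht => if_pos (show t < i from Finset.mem_range.1 ht)
    · simp
  · refine Finset.sum_congr rfl fun t _ => ?_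
    simp only []
    rw [if_neg (by omega), if_neg (by omega)]

/-- Degrees indexed by `ℕ` let the index shifts in block sums be made without bounds. -/
theorem exists_nat_extension {N : ℕ} (d : Fin N → ℤ) : ∃ d' : ℕ → ℤ, d = fun t : Fin N => d' t :=
  ⟨fun t => if h : t < N then d ⟨t, h⟩ else 0, by ext t; simp⟩

theorem sum_replaceBlock {N m n : ℕ} (h : N + 1 = m + n) (i : Fin m) (d : ℕ → ℤ) :
    ∑ t, replaceBlock h i id (∑ u : Fin n, d (i + u) - 1) (fun t : Fin N => d t) t =
      ∑ t : Fin N, d t - 1 := by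
  simp only [replaceBlock, Fin.lt_def, Fin.ext_iff, dite_eq_ite, id]
  rw [sum_ite_eq_sum_block i d (fun t => d (t + n - 1)), sum_eq_sum_block h]
  simp only [show ∀ t, (i : ℕ) + 1 + t + n - 1 = i + n + t by intro t; omega]
  ring

/-- The signs in the square of a coderivation are those of a `Dend_∞`-algebra. -/
theorem sum_sign_exponents {N m p : ℕ} (h : N + 1 = m + (p + 1)) (i : Fin m) (d : ℕ → ℤ) :
    ∑ t : Fin m, (if (t : ℕ) < i then ((m : ℤ) - 1 - t) * d t + -1 * d t
      else if (t : ℕ) = i then ((m : ℤ) - 1 - i) * (∑ u : Fin (p + 1), d (i + u) - 1) +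
        ∑ u : Fin (p + 1), (((p + 1 : ℕ) : ℤ) - 1 - u) * d (i + u)
      else ((m : ℤ) - 1 - t) * d (t + p)) =
    ∑ t : Fin N, ((N : ℤ) - 1 - t) * d t + (N + 1) +
      (((i : ℤ) + 1) * ((p : ℤ) + 2) + ((p : ℤ) + 1) * ∑ t ∈ Finset.range i, (d t - 1)) +
      2 * (-(((p : ℤ) + 1) * ∑ t ∈ Finset.range i, d t + m + p + 1)) := by
  have hN : (N : ℤ) = m + p := by omega
  rw [sum_ite_eq_sum_block i (fun t => ((m : ℤ) - 1 - t) * d t + -1 * d t)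
    (fun t => ((m : ℤ) - 1 - t) * d (t + p)),
    sum_eq_sum_block h i (fun t => ((N : ℤ) - 1 - t) * d t)]
  -- In front of the block, shortening the word by `p` letters changes the exponent by `p * d t`,
  -- and the Koszul sign of the coderivation contributes one more `d t`.
  have h₁ : ∑ t ∈ Finset.range i, (((m : ℤ) - 1 - t) * d t + -1 * d t) =
      ∑ t ∈ Finset.range i, ((N : ℤ) - 1 - t) * d t - (p + 1) * ∑ t ∈ Finset.range i, d t := by
    rw [Finset.mul_sum, ← Finset.sum_sub_distrib]
    exact Finset.sum_congr rfl fun t _ => by rw [hN]; ring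
  -- In the block, the inner and outer suspension exponents add up to those of the long word. Only
  -- the drop of the block's degree by one leaves a remainder, `-(m - 1 - i)`.
  have h₂ : ∑ u : Fin (p + 1), (((p + 1 : ℕ) : ℤ) - 1 - u) * d (i + u) =
      ∑ u : Fin (p + 1), ((N : ℤ) - 1 - (i + u : ℕ)) * d (i + u) -
        (m - 1 - i) * ∑ u : Fin (p + 1), d (i + u) := by
    rw [Finset.mul_sum, ← Finset.sum_sub_distrib]
    exact Finset.sum_congr rfl fun t _ => by rw [hN]; push_cast; ring
  have h₃ : ∑ t ∈ Finset.range (m - 1 - i), ((m : ℤ) - 1 - (i + 1 + t : ℕ)) * d (i + 1 + t + p) =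
      ∑ t ∈ Finset.range (m - 1 - i), ((N : ℤ) - 1 - (i + (p + 1) + t : ℕ)) *
        d (i + (p + 1) + t) := by
    refine Finset.sum_congr rfl fun t _ => ?_
    rw [hN, show (i : ℕ) + 1 + t + p = i + (p + 1) + t by omega]
    push_cast
    ring
  rw [h₁, h₂, h₃, Finset.sum_sub_distrib, Finset.sum_const, Finset.card_range, nsmul_eq_mul, hN]
  ring

end Signs

/-! ### Degrees, and squares of coderivations. -/

section Degrees

variable {K V : Type*} [Field K] [AddCommGroup V] [Module K V] (𝒱 : ℤ → Submodule K V)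

theorem pointedWord_mem_diassDegree {n : ℕ} {a : Fin n → V} {d : Fin n → ℤ}
    (ha : ∀ t, a t ∈ 𝒱 (d t)) (r : Fin n) : pointedWord K a r ∈ diassDegree 𝒱 (∑ t, d t) :=
  Submodule.subset_span ⟨n, a, d, r, ha, rfl, rfl⟩

theorem toLetters_mem {p : ℤ} {x : Diass K V} (hx : x ∈ diassDegree 𝒱 p) :
    toLetters K V x ∈ 𝒱 p := by
  induction hx using Submodule.span_induction with
  | zero => simp
  | add x y _ _ hx hy => rw [map_add]; exact add_mem hx hy
  | smul c x _ hx => rw [map_smul]; exact Submodule.smul_mem _ _ hx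
  | mem x hx =>
    obtain ⟨n, a, d, r, ha, rfl, rfl⟩ := hx
    by_cases hn : n = 1
    · subst hn
      obtain rfl : r = 0 := Subsingleton.elim _ _
      have : pointedWord K a 0 = word K [] (a 0) [] := by simp [pointedWord]
      rw [this, toLetters_word_nil]
      simpa using ha 0
    · have hr := r.2
      rw [pointedWord, toLetters_word_of_ne]
      · exact zero_mem _
      · by_contra! hc
        have h₁ := congrArg List.length hc.1
        have h₂ := congrArg List.length hc.2
        simp at h₁ h₂
        omega

/-- `B : TV ⊗ V ⊗ TV → V` has degree `-1`. -/
def LowersDegree (B : Diass K V →ₗ[K] V) : Prop :=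
  ∀ (n : ℕ) (a : Fin n → V) (d : Fin n → ℤ) (r : Fin n), (∀ t, a t ∈ 𝒱 (d t)) →
    B (pointedWord K a r) ∈ 𝒱 (∑ t, d t - 1)

variable {𝒱}

theorem LowersDegree.blockValue_mem {B : Diass K V →ₗ[K] V} (hB : LowersDegree 𝒱 B) {N m n : ℕ}
    (h : N + 1 = m + n) (i : Fin m) (r : Fin N) {a : Fin N → V} {d : ℕ → ℤ}
    (ha : ∀ t : Fin N, a t ∈ 𝒱 (d t)) :
    blockValue B n h i r a ∈ 𝒱 (∑ u : Fin n, d (i + u) - 1) := by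
  rw [blockValue, Finsupp.linearCombination_apply]
  exact Submodule.sum_mem _ fun u _ => Submodule.smul_mem _ _
    (hB n _ (fun u => d (i + u)) u fun u => ha ⟨i + u, by omega⟩)

variable [DirectSum.Decomposition 𝒱]

theorem LowersDegree.contractDiass_mem {B : Diass K V →ₗ[K] V} (hB : LowersDegree 𝒱 B) (e : ℤ)
    {p : ℤ} {x : Diass K V} (hx : x ∈ diassDegree 𝒱 p) :
    contractDiass (signMap 𝒱 e) B x ∈ diassDegree 𝒱 (p + -1) := by
  induction hx using Submodule.span_induction with
  | zero => simp
  | add x y _ _ hx hy => rw [map_add]; exact add_mem hx hy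
  | smul c x _ hx => rw [map_smul]; exact Submodule.smul_mem _ _ hx
  | mem x hx =>
    obtain ⟨N, a, d, r, ha, rfl, rfl⟩ := hx
    obtain ⟨d, rfl⟩ := exists_nat_extension d
    rw [contractDiass_pointedWord]
    refine Submodule.sum_mem _ fun p _ => Submodule.sum_mem _ fun l _ => ?_
    rw [← sub_eq_add_neg, ← sum_replaceBlock (succ_eq_sub_add_succ p) l d]
    refine pointedWord_mem_diassDegree 𝒱 (fun t => ?_) _
    simp only [replaceBlock]
    split_ifs
    · exact signMap_mem 𝒱 e (ha ⟨t, _⟩)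
    · exact hB.blockValue_mem _ _ _ ha
    · exact ha ⟨t + (p + 1) - 1, _⟩

theorem LowersDegree.isCoderivation {B : Diass K V →ₗ[K] V} (hB : LowersDegree 𝒱 B) :
    IsCoderivation 𝒱 (-1) (contractDiass (signMap 𝒱 (-1)) B) where
  degree _ _ hx := hB.contractDiass_mem (-1) hx
  -- `diassMap (signMap 𝒱 (-1))` and `diassSignMap 𝒱 (-1)` agree by definition: the sign of a word
  -- is the product of the signs of its letters.
  comul₁_comp := comul₁_contractDiass _ _
  comul₂_comp := comul₂_contractDiass _ _

theorem IsCoderivation.lowersDegree {D : Diass K V →ₗ[K] Diass K V}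
    (hD : IsCoderivation 𝒱 (-1) D) : LowersDegree 𝒱 (toLetters K V ∘ₗ D) :=
  fun _ _ _ r ha => toLetters_mem 𝒱 (hD.degree _ _ (pointedWord_mem_diassDegree 𝒱 ha r))

/-- A coderivation of degree `-1` is the one built from its corestriction. -/
theorem IsCoderivation.eq_contractDiass {D : Diass K V →ₗ[K] Diass K V}
    (hD : IsCoderivation 𝒱 (-1) D) :
    D = contractDiass (signMap 𝒱 (-1)) (toLetters K V ∘ₗ D) := by
  have hC := hD.lowersDegree.isCoderivation
  set C := contractDiass (signMap 𝒱 (-1)) (toLetters K V ∘ₗ D) with hCdef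
  -- For fixed `S` and `T` the coderivation identity is linear in the map, so `D - C` satisfies it
  -- too, with zero corestriction.
  have hmap : ∀ S T : Diass K V →ₗ[K] Diass K V,
      TensorProduct.map S (D + (-1 : K) • C) + TensorProduct.map (D + (-1 : K) • C) T =
        TensorProduct.map S D + TensorProduct.map D T +
          (-1 : K) • (TensorProduct.map S C + TensorProduct.map C T) := by
    intro S T
    rw [TensorProduct.map_add_right, TensorProduct.map_add_left, TensorProduct.map_smul_right,
      TensorProduct.map_smul_left, smul_add]
    abel
  rw [← sub_eq_zero, sub_eq_add_neg, ← neg_one_smul K C]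
  refine eq_zero_of_toLetters_comp_eq_zero (S := diassSignMap 𝒱 (-1)) (T := LinearMap.id)
    ?_ ?_ ?_
  · rw [LinearMap.comp_add, LinearMap.comp_smul, hD.comul₁_comp, hC.comul₁_comp, hmap]
    rfl
  · rw [LinearMap.comp_add, LinearMap.comp_smul, hD.comul₂_comp, hC.comul₂_comp, hmap]
    rfl
  · rw [LinearMap.comp_add, LinearMap.comp_smul, hCdef, toLetters_comp_contractDiass]
    module

/-- `D` shifts degrees by an odd number, hence it anticommutes with the parity sign. -/
theorem IsCoderivation.diassSignMap_comp {D : Diass K V →ₗ[K] Diass K V}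
    (hD : IsCoderivation 𝒱 (-1) D) :
    diassSignMap 𝒱 (-1) ∘ₗ D = -(D ∘ₗ diassSignMap 𝒱 (-1)) := by
  refine hom_ext_homogeneous 𝒱 fun n a d r ha => ?_
  have hx := pointedWord_mem_diassDegree 𝒱 ha r
  rw [LinearMap.neg_apply, LinearMap.comp_apply, LinearMap.comp_apply,
    diassSignMap_apply 𝒱 (-1) _ hx, diassSignMap_apply 𝒱 (-1) _ (hD.degree _ _ hx), map_smul,
    mul_add, neg_one_zpow_add]
  simp only [neg_mul, one_mul, neg_neg, zpow_one, mul_neg, mul_one]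
  exact neg_smul (R := K) (M := Diass K V) _ _

/-- The square of a coderivation of degree `-1` is determined by its corestriction. -/
theorem IsCoderivation.comp_self_eq_zero_iff {D : Diass K V →ₗ[K] Diass K V}
    (hD : IsCoderivation 𝒱 (-1) D) : D ∘ₗ D = 0 ↔ toLetters K V ∘ₗ D ∘ₗ D = 0 := by
  refine ⟨fun h => by rw [h, LinearMap.comp_zero], fun h => ?_⟩
  -- The two cross terms cancel because `D` anticommutes with the sign map.
  have key : (TensorProduct.map (diassSignMap 𝒱 (-1)) D + TensorProduct.map D LinearMap.id) ∘ₗ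
      (TensorProduct.map (diassSignMap 𝒱 (-1)) D + TensorProduct.map D LinearMap.id) =
      TensorProduct.map (diassSignMap 𝒱 (-1) ∘ₗ diassSignMap 𝒱 (-1)) (D ∘ₗ D) +
        TensorProduct.map (D ∘ₗ D) LinearMap.id := by
    simp only [LinearMap.comp_add, LinearMap.add_comp, ← TensorProduct.map_comp,
      LinearMap.id_comp, LinearMap.comp_id, hD.diassSignMap_comp]
    rw [← neg_one_smul K (D ∘ₗ _), TensorProduct.map_smul_left]
    module
  refine eq_zero_of_toLetters_comp_eq_zero (T := LinearMap.id)
    (S := diassSignMap 𝒱 (-1) ∘ₗ diassSignMap 𝒱 (-1)) ?_ ?_ h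
  · rw [← key, LinearMap.comp_assoc, ← hD.comul₁_comp, ← LinearMap.comp_assoc,
      ← LinearMap.comp_assoc, hD.comul₁_comp]
  · rw [← key, LinearMap.comp_assoc, ← hD.comul₂_comp, ← LinearMap.comp_assoc,
      ← LinearMap.comp_assoc, hD.comul₂_comp]

end Degrees

/-! ### Operations on `A` and corestrictions on `sA`. -/

section Correspondence

variable {K A : Type*} [Field K] [AddCommGroup A] [Module K A] (𝒜 : ℤ → Submodule K A)
  [DirectSum.Decomposition 𝒜]

/-- The corestriction `s ∘ μ_{k,[r]} ∘ (s⁻¹)^{⊗ k}` of the coderivation associated to `μ`. -/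
def corestriction (μ : Ops K A) : Diass K A →ₗ[K] A :=
  ofMultilinear fun k r =>
    (μ k r).compLinearMap fun t => signMap (suspension 𝒜) ((k : ℤ) - 1 - t)

/-- The operations `s⁻¹ ∘ B ∘ s^{⊗ k}` associated to a linear map `B : TV ⊗ V ⊗ TV → V`. -/
def desuspend (B : Diass K A →ₗ[K] A) : Ops K A := fun k r =>
  (B.compMultilinearMap (pointedWordMultilinear K r)).compLinearMap fun t =>
    signMap (suspension 𝒜) ((k : ℤ) - 1 - t)

theorem corestriction_pointedWord (μ : Ops K A) {k : ℕ} (a : Fin k → A) (r : Fin k) :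
    corestriction 𝒜 μ (pointedWord K a r) =
      μ k r fun t => signMap (suspension 𝒜) ((k : ℤ) - 1 - t) (a t) := by
  rw [corestriction, ofMultilinear_pointedWord, MultilinearMap.compLinearMap_apply]

theorem desuspend_apply (B : Diass K A →ₗ[K] A) {k : ℕ} (a : Fin k → A) (r : Fin k) :
    desuspend 𝒜 B k r a =
      B (pointedWord K (fun t => signMap (suspension 𝒜) ((k : ℤ) - 1 - t) (a t)) r) := rfl

/-- Both passages apply the same letterwise signs, and `signMap` is an involution. -/
theorem desuspend_corestriction (μ : Ops K A) : desuspend 𝒜 (corestriction 𝒜 μ) = μ := by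
  funext k r
  ext a
  simp only [desuspend_apply, corestriction_pointedWord, signMap_signMap]

theorem corestriction_desuspend (B : Diass K A →ₗ[K] A) :
    corestriction 𝒜 (desuspend 𝒜 B) = B := by
  refine hom_ext_pointedWord fun n a i => ?_
  simp only [desuspend_apply, corestriction_pointedWord, signMap_signMap]

variable {𝒜}

theorem corestriction_pointedWord_of_mem (μ : Ops K A) {k : ℕ} {a : Fin k → A} {e : Fin k → ℤ}
    (ha : ∀ t, a t ∈ suspension 𝒜 (e t)) (r : Fin k) :
    corestriction 𝒜 μ (pointedWord K a r) =
      (-1 : K) ^ (∑ t : Fin k, ((k : ℤ) - 1 - t) * e t) • μ k r a := by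
  rw [corestriction_pointedWord, ← neg_one_zpow_sum, ← MultilinearMap.map_smul_univ]
  congr 1
  ext t
  exact signMap_apply _ _ (ha t)

/-- The `k` desuspensions turn degree `k - 2` into `-2` relative to the degrees in `sA`, and
suspending the value gives `-1`. -/
theorem lowersDegree_corestriction {μ : Ops K A}
    (hμ : ∀ (k : ℕ) (r : Fin k) (a : Fin k → A) (d : Fin k → ℤ), (∀ t, a t ∈ 𝒜 (d t)) →
      μ k r a ∈ 𝒜 ((∑ t, d t) + ((k : ℤ) - 2))) :
    LowersDegree (suspension 𝒜) (corestriction 𝒜 μ) := by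
  intro n a d r ha
  rw [corestriction_pointedWord_of_mem μ ha]
  refine Submodule.smul_mem _ _ ?_
  have := hμ n r a (fun t => d t - 1) ha
  rw [Finset.sum_sub_distrib, Finset.sum_const, Finset.card_univ, Fintype.card_fin,
    nsmul_eq_mul, mul_one] at this
  rwa [suspension, show ∑ t, d t - 1 - 1 = ∑ t, d t - n + (n - 2) by ring]

theorem desuspend_mem {B : Diass K A →ₗ[K] A} (hB : LowersDegree (suspension 𝒜) B) (k : ℕ)
    (r : Fin k) (a : Fin k → A) (d : Fin k → ℤ) (ha : ∀ t, a t ∈ 𝒜 (d t)) :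
    desuspend 𝒜 B k r a ∈ 𝒜 ((∑ t, d t) + ((k : ℤ) - 2)) := by
  have := hB k (fun t => signMap (suspension 𝒜) ((k : ℤ) - 1 - t) (a t)) (fun t => d t + 1) r
    fun t => signMap_mem _ _ (by simpa [suspension] using ha t)
  rw [Finset.sum_add_distrib, Finset.sum_const, Finset.card_univ, Fintype.card_fin,
    nsmul_eq_mul, mul_one, suspension] at this
  rwa [desuspend_apply, show ∑ t, d t + ((k : ℤ) - 2) = ∑ t, d t + k - 1 - 1 by ring]

/-- The suspension sign depends on the degrees but not on the symbol, so it comes out of the linear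
extension to `K[C_n]`. -/
theorem blockValue_corestriction (μ : Ops K A) {N m n : ℕ} (h : N + 1 = m + n) (i : Fin m)
    (r : Fin N) {a : Fin N → A} {d : ℕ → ℤ} (ha : ∀ t : Fin N, a t ∈ suspension 𝒜 (d t)) :
    blockValue (corestriction 𝒜 μ) n h i r a =
      (-1 : K) ^ (∑ u : Fin n, ((n : ℤ) - 1 - u) * d (i + u)) •
        opLin μ n (innerSymbol K n i r) fun u : Fin n => a ⟨i + u, by omega⟩ := by
  have hb : ∀ u : Fin n, a ⟨i + u, by omega⟩ ∈ suspension 𝒜 (d (i + u)) :=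
    fun u => ha ⟨i + u, by omega⟩
  simp only [blockValue, opLin, Finsupp.linearCombination_apply, Finsupp.sum, sum_apply,
    smul_apply, corestriction_pointedWord_of_mem μ hb, Finset.smul_sum]
  exact Finset.sum_congr rfl fun u _ => smul_comm _ _ _

/-- The first sign depends on the long word alone and is common to all blocks; the second is the
`Dend_∞` sign, with `d t - 1` the degree in `A`. -/
theorem corestriction_replaceBlock {μ : Ops K A}
    (hB : LowersDegree (suspension 𝒜) (corestriction 𝒜 μ)) {N m p : ℕ}
    (h : N + 1 = m + (p + 1)) (i : Fin m) (r : Fin N) {a : Fin N → A} {d : ℕ → ℤ}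
    (ha : ∀ t : Fin N, a t ∈ suspension 𝒜 (d t)) :
    corestriction 𝒜 μ (pointedWord K (replaceBlock h i (signMap (suspension 𝒜) (-1))
      (blockValue (corestriction 𝒜 μ) (p + 1) h i r a) a) (outerSymbol h i r)) =
    (-1 : K) ^ (∑ t : Fin N, ((N : ℤ) - 1 - t) * d t + (N + 1)) •
      (-1 : K) ^ (((i : ℤ) + 1) * ((p : ℤ) + 2) +
        ((p : ℤ) + 1) * ∑ t ∈ Finset.range i, (d t - 1)) • partialComp μ h i r a := by
  rw [corestriction_pointedWord, smul_smul, ← neg_one_zpow_add]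
  have hsign := congrArg (fun e => (-1 : K) ^ e) (sum_sign_exponents h i d)
  simp only [neg_one_zpow_add _ (2 * _), neg_one_zpow_two_mul, mul_one] at hsign
  rw [← hsign, ← neg_one_zpow_sum, partialComp, ← MultilinearMap.map_smul_univ]
  congr 1
  ext t
  simp only [replaceBlock, Fin.lt_def, Fin.ext_iff]
  split_ifs with h₁ h₂
  · rw [signMap_apply _ _ (ha _), map_smul, signMap_apply _ _ (ha _), smul_smul,
      ← neg_one_zpow_add, add_comm]
  · rw [signMap_apply _ _ (hB.blockValue_mem h i r ha), blockValue_corestriction μ h i r ha,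
      smul_smul, ← neg_one_zpow_add, h₂]
  · exact signMap_apply _ _ (ha ⟨t + (p + 1) - 1, _⟩)

theorem sum_filter_lt_eq_sum_range {N l : ℕ} (hl : l ≤ N) (f : ℕ → ℤ) :
    ∑ t ∈ Finset.univ.filter (fun t : Fin N => (t : ℕ) < l), f t = ∑ t ∈ Finset.range l, f t := by
  rw [Finset.sum_filter, ← Finset.sum_range (fun t => if t < l then f t else 0),
    ← Finset.sum_filter]
  congr 1
  ext t
  simp only [Finset.mem_filter, Finset.mem_range]
  omega

/-- On homogeneous elements, the corestriction of the square of the coderivation associated to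
`μ` is, up to a sign, the left hand side of the `Dend_∞` identity. -/
theorem corestriction_contractDiass {μ : Ops K A}
    (hB : LowersDegree (suspension 𝒜) (corestriction 𝒜 μ)) {N : ℕ} (r : Fin N) {a : Fin N → A}
    {d : Fin N → ℤ} (ha : ∀ t, a t ∈ 𝒜 (d t)) :
    ∃ e : ℤ, corestriction 𝒜 μ (contractDiass (signMap (suspension 𝒜) (-1))
      (corestriction 𝒜 μ) (pointedWord K a r)) = (-1 : K) ^ e •
      ∑ p : Fin N, ∑ l : Fin (N - p),
        (-1 : K) ^ (((l : ℤ) + 1) * ((p : ℤ) + 2)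
          + ((p : ℤ) + 1) * ∑ t ∈ Finset.univ.filter (fun t : Fin N => (t : ℕ) < l), d t) •
        partialComp μ (succ_eq_sub_add_succ p) l r a := by
  obtain ⟨d, rfl⟩ := exists_nat_extension d
  have ha' : ∀ t : Fin N, a t ∈ suspension 𝒜 ((fun t => d t + 1) t) :=
    fun t => by simpa [suspension] using ha t
  refine ⟨∑ t : Fin N, ((N : ℤ) - 1 - t) * (d t + 1) + (N + 1), ?_⟩
  simp only [contractDiass_pointedWord, map_sum, Finset.smul_sum]
  refine Finset.sum_congr rfl fun p _ => Finset.sum_congr rfl fun l _ => ?_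
  rw [corestriction_replaceBlock (d := fun t => d t + 1) hB _ l r ha']
  simp only [add_sub_cancel_right]
  rw [sum_filter_lt_eq_sum_range (by omega)]

/-- The square vanishes once its corestriction does, and this may be tested on pointed words with
homogeneous letters, where it is an invertible sign times the `Dend_∞` expression. -/
theorem isDendInfty_iff {μ : Ops K A} (hB : LowersDegree (suspension 𝒜) (corestriction 𝒜 μ))
    (hμ : ∀ (k : ℕ) (r : Fin k) (a : Fin k → A) (d : Fin k → ℤ), (∀ t, a t ∈ 𝒜 (d t)) →
      μ k r a ∈ 𝒜 ((∑ t, d t) + ((k : ℤ) - 2))) :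
    IsDendInfty 𝒜 μ ↔
      contractDiass (signMap (suspension 𝒜) (-1)) (corestriction 𝒜 μ) ∘ₗ
        contractDiass (signMap (suspension 𝒜) (-1)) (corestriction 𝒜 μ) = 0 := by
  rw [hB.isCoderivation.comp_self_eq_zero_iff, ← LinearMap.comp_assoc,
    toLetters_comp_contractDiass]
  constructor
  · intro h
    refine hom_ext_homogeneous 𝒜 fun n a d r ha => ?_
    obtain ⟨e, he⟩ := corestriction_contractDiass hB r ha
    rw [LinearMap.comp_apply, he, h.identity n r a d ha, smul_zero, LinearMap.zero_apply]
  · refine fun h => ⟨hμ, fun N r a d ha => ?_⟩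
    obtain ⟨e, he⟩ := corestriction_contractDiass hB r ha
    rw [← LinearMap.comp_apply, h, LinearMap.zero_apply] at he
    exact (smul_eq_zero.1 he.symm).resolve_left (zpow_ne_zero _ (neg_ne_zero.2 one_ne_zero))

variable (𝒜)

/-- The correspondence between `Dend_∞`-algebra structures on `A` and coderivations of square zero
of `Diass^c(sA)`. -/
def dendInftyEquivCoderivation : {μ : Ops K A // IsDendInfty 𝒜 μ} ≃
    {D : Diass K A →ₗ[K] Diass K A // IsCoderivation (suspension 𝒜) (-1) D ∧ D ∘ₗ D = 0} where
  toFun μ := ⟨contractDiass (signMap (suspension 𝒜) (-1)) (corestriction 𝒜 μ.1),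
    (lowersDegree_corestriction μ.2.degree).isCoderivation,
    (isDendInfty_iff (lowersDegree_corestriction μ.2.degree) μ.2.degree).1 μ.2⟩
  invFun D := ⟨desuspend 𝒜 (toLetters K A ∘ₗ D.1), by
    refine (isDendInfty_iff ?_ (desuspend_mem D.2.1.lowersDegree)).2 ?_
    · rw [corestriction_desuspend]
      exact D.2.1.lowersDegree
    · rw [corestriction_desuspend, ← D.2.1.eq_contractDiass, D.2.2]⟩
  left_inv μ := Subtype.ext <| by
    dsimp only
    rw [toLetters_comp_contractDiass, desuspend_corestriction]
  right_inv D := Subtype.ext <| by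
    dsimp only
    rw [corestriction_desuspend, ← D.2.1.eq_contractDiass]

end Correspondence

end DendInfty

end

theorem theorem4p7 {K A : Type*} [Field K] [CharZero K] [AddCommGroup A] [Module K A]
    (𝒜 : ℤ → Submodule K A) [DirectSum.Decomposition 𝒜] :
    ∃ Φ : {μ : DendInfty.Ops K A // DendInfty.IsDendInfty 𝒜 μ} ≃
        {D : DendInfty.Diass K A →ₗ[K] DendInfty.Diass K A //
          DendInfty.IsCoderivation (DendInfty.suspension 𝒜) (-1) D ∧ D ∘ₗ D = 0},
      ∀ (μ : {μ : DendInfty.Ops K A // DendInfty.IsDendInfty 𝒜 μ})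
        (k : ℕ) (r : Fin k) (v : Fin k → A) (e : Fin k → ℤ),
        (∀ t, v t ∈ DendInfty.suspension 𝒜 (e t)) →
          DendInfty.toLetters K A ((Φ μ).1 (DendInfty.pointedWord K v r)) =
            (-1 : K) ^ (∑ t : Fin k, ((k : ℤ) - 1 - t) * e t) • μ.1 k r v := by
  refine ⟨DendInfty.dendInftyEquivCoderivation 𝒜, fun μ k r v e hv => ?_⟩
  rw [← DendInfty.corestriction_pointedWord_of_mem μ.1 hv r]
  exact LinearMap.congr_fun (DendInfty.toLetters_comp_contractDiass _ _) _
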